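/- **Theorem 1 (iteration complexity of LAPG).** *Setting.* Consider a Markov decision process with state space $\mathcal S$, action space $\mathcal A$, transition kernel $\mathbb P(\cdot\mid s,a)$, discount factor $\gamma\in(0,1)$, and $M\ge 1$ learners; learner $m$ has a loss $\ell_m:\mathcal S\times\mathcal A\to\mathbb R$ and an initial state distribution $\rho_m$. Let $\pi(a\mid s;\theta)>0$, $\theta\in\mathbb R^d$, be a parameterized policy (a probability density in $a$ with respect to a fixed reference measure). Let $\mathbb P_m(\cdot\mid\theta)$ be the law of the trajectory $s_0\sim\rho_m$, $a_t\sim\pi(\cdot\mid s_t;\theta)$, $s_{t+1}\sim\mathbb P(\cdot\mid s_t,a_t)$, and put $$\mathcal L_m(\theta)=\mathbb E_{\mathbb P_m(\cdot\mid\theta)}\Big[\sum_{t=0}^\infty\gamma^t\ell_m(s_t,a_t)\Big],\qquad \mathcal L(\theta)=\sum_{m=1}^M\mathcal L_m(\theta),\qquad \mathcal L^*=\inf_\theta\mathcal L(\theta).$$ *Assumption 1.* $0\le\ell_m(s,a)\le\bar\ell_m$ for all $m,s,a$. *Assumption 2.* $\log\pi(a\mid s;\cdot)$ is twice differentiable,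 with $\|\nabla\log\pi(a\mid s;\theta)\|\le G$ and $\big|\frac{\partial^2}{\partial\theta_i\partial\theta_j}\log\pi(a\mid s;\theta)\big|\le F$ for all $s,a,\theta,i,j$. *Constants.* For $T\ge0$, $N,K\ge1$, $\delta\in(0,1)$ let $$V_m=\frac{2G\bar\ell_m}{(1-\gamma)^2},\quad \sigma^2_{m,N,\delta/K}=\frac{2\log(2K/\delta)V_m^2}{N},\quad \sigma^2_{N,\delta/K}=M\sum_{m}\sigma^2_{m,N,\delta/K},\quad \sigma_T=\sum_m\frac{G\bar\ell_m\,\gamma^{T+1}}{1-\gamma}\Big(T+1+\frac1{1-\gamma}\Big).$$ *Algorithm (LAPG).* Fix a stepsize $\alpha>0$, weights $\xi_1,\dots,\xi_D\ge0$, an initial $\theta^1$, past values $\theta^0,\theta^{-1},\dots$, and initial stored gradients $g_m^0$. At iteration $k=1,\dots,K$ each learner $m$ draws, given the past, $N$ independent episodes $(s_0^{n,m},a_0^{n,m},\dots,s_T^{n,m},a_T^{n,m})$ with law $\mathbb P_m(\cdot\mid\theta^k)$ truncated at $T$ (the episodes of different learners with the same index $n$ may be dependent) and computes $$\hat g_m^k=\frac1N\sum_{n=1}^N\sum_{t=0}^T\Big(\sum_{\tau=0}^t\nabla\log\pi(a_\tau^{n,m}\mid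 s_\tau^{n,m};\theta^k)\Big)\gamma^t\ell_m(s_t^{n,m},a_t^{n,m}).$$ If $$\|\hat g_m^k-g_m^{k-1}\|^2\ge\frac1{\alpha^2M^2}\sum_{d=1}^D\xi_d\|\theta^{k+1-d}-\theta^{k-d}\|^2+6\sigma^2_{m,N,\delta/K},$$ then $g_m^k=\hat g_m^k$ (upload); otherwise $g_m^k=g_m^{k-1}$. Then $\theta^{k+1}=\theta^k-\alpha\sum_m g_m^k$. Put $$\mathbb V^1=\mathcal L(\theta^1)-\mathcal L^*+\frac3{2\alpha}\sum_{d=1}^D\sum_{\tau=d}^D\xi_\tau\|\theta^{2-d}-\theta^{1-d}\|^2.$$ *Claim.* Under Assumptions 1 and 2, $\mathcal L$ is differentiable and $\nabla\mathcal L$ is Lipschitz with constant $$\Big(dF+G^2+\frac{2\gamma G^2}{1-\gamma}\Big)\frac{\sum_m\bar\ell_m}{(1-\gamma)^2}.$$ Let $L>0$ be any Lipschitz constant of $\nabla\mathcal L$ and let $0<\alpha\le\big(1-3\sum_{d=1}^D\xi_d\big)/L$. Then for all $T\ge0$, $K,N\ge1$ and $\delta\in(0,1)$, with probability at least $1-\delta$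 the LAPG iterates satisfy $$\frac1K\sum_{k=1}^K\|\nabla\mathcal L(\theta^k)\|^2\le\frac{2}{\alpha K}\mathbb V^1+3\sigma_T^2+21\sigma^2_{N,\delta/K}.$$ Moreover there are constants $c_T,c_K,c_N>0$ and $C_T,C_K,C_N$, not depending on $\varepsilon$ and $\delta$, such that for all $\varepsilon\in(0,1/2]$ and $\delta\in(0,1)$ the right-hand side is at most $\varepsilon$ whenever $T\ge c_T\log(1/\varepsilon)$, $K\ge c_K/\varepsilon$ and $N\ge c_N\log(K/\delta)/\varepsilon$, and such $T$, $K\geq 1$, $N\geq 1$ exist with $T\le C_T\log(1/\varepsilon)$, $K\le C_K/\varepsilon$ and $N\le C_N\log(K/\delta)/\varepsilon$; that is, $T=\mathcal O(\log(1/\varepsilon))$, $K=\mathcal O(1/\varepsilon)$ and $N=\mathcal O(\log(K/\delta)/\varepsilon)$ suffice. -/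

import Mathlib

open MeasureTheory ProbabilityTheory

/-- Data of a distributed reinforcement learning problem with `M` learners on a common Markov
decision process with state space `S` and action space `A`, together with a policy parameterized
by `θ ∈ ℝ^d`.  The policy is given by its probability density `π θ s a = π(a | s; θ)` with respect
to a reference measure `ν` on `A` (Lebesgue measure, counting measure, ...); it is positive so that
`log π` makes sense.  Each learner has its own loss and its own initial state distribution (these
distributions coincide in the multi-agent setting, and may differ in the parallel setting). -/
structure DRLProblem (S A : Type*) [MeasurableSpace S] [MeasurableSpace A] (d M : ℕ) where
  /-- transition kernel of the state -/
  trans : Kernel (S × A) S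
  trans_markov : IsMarkovKernel trans
  /-- discount factor -/
  γ : ℝ
  γ_pos : 0 < γ
  γ_lt_one : γ < 1
  /-- initial state distributions -/
  ρ : Fin M → Measure S
  ρ_prob : ∀ m, IsProbabilityMeasure (ρ m)
  /-- instantaneous losses -/
  loss : Fin M → S → A → ℝ
  loss_meas : ∀ m, Measurable (Function.uncurry (loss m))
  /-- reference measure on the actions -/
  ν : Measure A
  ν_sfinite : SFinite ν
  /-- policy density `π(a | s; θ)` -/
  π : EuclideanSpace ℝ (Fin d) → S → A → ℝ
  π_meas : Measurable fun p : EuclideanSpace ℝ (Fin d) × S × A => π p.1 p.2.1 p.2.2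
  π_pos : ∀ θ s a, 0 < π θ s a
  π_total : ∀ θ s, ∫⁻ a, ENNReal.ofReal (π θ s a) ∂ν = 1

namespace DRLProblem

attribute [instance] trans_markov ρ_prob ν_sfinite

variable {S A : Type*} [MeasurableSpace S] [MeasurableSpace A] {d M : ℕ}

section Model

variable (P : DRLProblem S A d M)

/-- The policy `π(· | s; θ)` as a kernel from states to actions. -/
noncomputable def policy (θ : EuclideanSpace ℝ (Fin d)) : Kernel S A :=
  Kernel.withDensity (Kernel.const S P.ν) fun s a => ENNReal.ofReal (P.π θ s a)

theorem measurable_density (θ : EuclideanSpace ℝ (Fin d)) :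
    Measurable (Function.uncurry fun (s : S) (a : A) => ENNReal.ofReal (P.π θ s a)) :=
  (P.π_meas.comp (measurable_const.prodMk measurable_id)).ennreal_ofReal

instance policy_markov (θ : EuclideanSpace ℝ (Fin d)) : IsMarkovKernel (P.policy θ) := by
  refine ⟨fun s => ⟨?_⟩⟩
  rw [policy, Kernel.withDensity_apply' _ (P.measurable_density θ)]
  simpa using P.π_total θ s

/-- One step `(s, a) ↦ (s', a')` of the state-action chain: `s' ∼ P(· | s, a)`,
`a' ∼ π(· | s'; θ)`. -/
noncomputable def step (θ : EuclideanSpace ℝ (Fin d)) : Kernel (S × A) (S × A) :=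
  P.trans ⊗ₖ Kernel.prodMkLeft (S × A) (P.policy θ)

instance step_markov (θ : EuclideanSpace ℝ (Fin d)) : IsMarkovKernel (P.step θ) := by
  unfold step; infer_instance

/-- The step kernel applied to the last entry of a history of state-action pairs. -/
noncomputable def stepHist (θ : EuclideanSpace ℝ (Fin d)) (n : ℕ) :
    Kernel (Π _ : Finset.Iic n, S × A) (S × A) :=
  (P.step θ).comap (fun x => x ⟨n, Finset.mem_Iic.2 le_rfl⟩) (measurable_pi_apply _)

instance stepHist_markov (θ : EuclideanSpace ℝ (Fin d)) (n : ℕ) :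
    IsMarkovKernel (P.stepHist θ n) := by
  unfold stepHist; infer_instance

/-- The law `ℙ(· | θ)` of the infinite trajectory `(s₀, a₀, s₁, a₁, …)` of learner `m`. -/
noncomputable def trajLaw (m : Fin M) (θ : EuclideanSpace ℝ (Fin d)) : Measure (ℕ → S × A) :=
  Kernel.trajMeasure (X := fun _ => S × A) ((P.ρ m) ⊗ₘ (P.policy θ)) (P.stepHist θ)

/-- The law of the truncated trajectory `(s₀, a₀, …, s_T, a_T)` of learner `m`. -/
noncomputable def episodeLaw (T : ℕ) (m : Fin M) (θ : EuclideanSpace ℝ (Fin d)) :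
    Measure (Fin (T + 1) → S × A) :=
  (P.trajLaw m θ).map fun x t => x t

/-- The cumulative discounted loss `𝓛_m(θ)` of learner `m`. -/
noncomputable def cumLoss (m : Fin M) (θ : EuclideanSpace ℝ (Fin d)) : ℝ :=
  ∫ x, ∑' t : ℕ, P.γ ^ t * P.loss m (x t).1 (x t).2 ∂(P.trajLaw m θ)

/-- The objective `𝓛(θ) = ∑_m 𝓛_m(θ)`. -/
noncomputable def totalLoss (θ : EuclideanSpace ℝ (Fin d)) : ℝ :=
  ∑ m, P.cumLoss m θ

/-- The score function `∇_θ log π(a | s; θ)`. -/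
noncomputable def score (θ : EuclideanSpace ℝ (Fin d)) (s : S) (a : A) :
    EuclideanSpace ℝ (Fin d) :=
  gradient (fun θ' => Real.log (P.π θ' s a)) θ

/-- The G(PO)MDP policy gradient estimate of learner `m` at `θ` from one episode. -/
noncomputable def gpomdp (T : ℕ) (m : Fin M) (θ : EuclideanSpace ℝ (Fin d))
    (x : Fin (T + 1) → S × A) : EuclideanSpace ℝ (Fin d) :=
  ∑ t : Fin (T + 1), (P.γ ^ (t : ℕ) * P.loss m (x t).1 (x t).2) •
    ∑ τ ∈ Finset.Iic t, P.score θ (x τ).1 (x τ).2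

/-- The mini-batch policy gradient estimate of learner `m` at `θ` from `N` episodes. -/
noncomputable def batchGrad {N T : ℕ} (m : Fin M) (θ : EuclideanSpace ℝ (Fin d))
    (x : Fin N → Fin (T + 1) → S × A) : EuclideanSpace ℝ (Fin d) :=
  (N : ℝ)⁻¹ • ∑ n, P.gpomdp T m θ (x n)

/-- Bounded losses: `ℓ_m(s, a) ∈ [0, ℓbar m]`. -/
def LossBounded (ℓbar : Fin M → ℝ) : Prop :=
  ∀ m s a, 0 ≤ P.loss m s a ∧ P.loss m s a ≤ ℓbar m

/-- The log-density is twice differentiable in `θ`, its gradient is bounded in norm by `G`, and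
its second partial derivatives are bounded in absolute value by `F`. -/
def ScoreBounded (G F : ℝ) : Prop :=
  ∀ s a, Differentiable ℝ (fun θ => Real.log (P.π θ s a)) ∧
    Differentiable ℝ (fderiv ℝ fun θ => Real.log (P.π θ s a)) ∧
    ∀ θ, ‖P.score θ s a‖ ≤ G ∧
      ∀ i j, |fderiv ℝ (fderiv ℝ fun θ' => Real.log (P.π θ' s a)) θ
        (EuclideanSpace.single i 1) (EuclideanSpace.single j 1)| ≤ F

end Model

section Constants

variable (P : DRLProblem S A d M) (ℓbar : Fin M → ℝ)

/-- A Lipschitz constant of `∇𝓛`, in terms of the bounds on the losses and on `log π`. -/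
noncomputable def smoothConst (G F : ℝ) : ℝ :=
  (d * F + G ^ 2 + 2 * P.γ * G ^ 2 / (1 - P.γ)) * (∑ m, ℓbar m) / (1 - P.γ) ^ 2

/-- The bound `V_m` on the deviation of a single-episode gradient estimate from its mean. -/
noncomputable def devBound (G : ℝ) (m : Fin M) : ℝ :=
  2 * G * ℓbar m / (1 - P.γ) ^ 2

/-- `σ²_{m,N,δ/K} = 2 log(2K/δ) V_m² / N`. -/
noncomputable def sigmaSqLearner (G : ℝ) (N K : ℕ) (δ : ℝ) (m : Fin M) : ℝ :=
  2 * Real.log (2 * K / δ) * P.devBound ℓbar G m ^ 2 / N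

/-- `σ²_{N,δ/K} = M ∑_m σ²_{m,N,δ/K}`. -/
noncomputable def sigmaSq (G : ℝ) (N K : ℕ) (δ : ℝ) : ℝ :=
  M * ∑ m, P.sigmaSqLearner ℓbar G N K δ m

/-- The bound `σ_T` on the error in the gradient caused by truncating the horizon at `T`. -/
noncomputable def sigmaT (G : ℝ) (T : ℕ) : ℝ :=
  ∑ m, G * ℓbar m * (T + 1 + 1 / (1 - P.γ)) * P.γ ^ (T + 1) / (1 - P.γ)

/-- The Lyapunov function `𝕍^k` along a sequence `θ` of parameters; the optimal value is the
infimum of `𝓛`, which is `𝓛(θ*)` if there is a minimizer `θ*`. -/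
noncomputable def lyapunov (α : ℝ) (D : ℕ) (ξ : ℕ → ℝ)
    (θ : ℤ → EuclideanSpace ℝ (Fin d)) (k : ℤ) : ℝ :=
  P.totalLoss (θ k) - (⨅ θ', P.totalLoss θ') +
    3 / (2 * α) * ∑ i ∈ Finset.Icc 1 D, ∑ τ ∈ Finset.Icc i D,
      ξ τ * ‖θ (k + 1 - i) - θ (k - i)‖ ^ 2

/-- The right-hand side `2 𝕍¹ / (α K) + 3 σ_T² + 21 σ²_{N,δ/K}`. -/
noncomputable def rateBound (G α : ℝ) (D : ℕ) (ξ : ℕ → ℝ)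
    (init : ℤ → EuclideanSpace ℝ (Fin d)) (T K N : ℕ) (δ : ℝ) : ℝ :=
  2 / (α * K) * P.lyapunov α D ξ init 1 + 3 * P.sigmaT ℓbar G T ^ 2 +
    21 * P.sigmaSq ℓbar G N K δ

end Constants

/-- `θ` are iterates of `K` iterations of LAPG, on the probability space `(Ω, μ)`, with stepsize
`α`, weights `ξ 1, …, ξ D` and threshold variances `σsq m`, using at each iteration `N` episodes
of horizon `T` per learner.

* `ℱ k` is the information available before iteration `k`;
* `x k m n` is the `n`-th episode of learner `m` at iteration `k`;
* `g k m` is the gradient of learner `m` held by the controller after iteration `k`, that is, the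
  one it uploaded most recently (`g 0 m` are the initial ones);
* `init j`, `j ≤ 1`, are the given initial parameter `θ^1` and the given values of
  `θ^0, θ^(-1), …`, which occur in the communication condition during the first iterations. -/
structure IsLAPG (P : DRLProblem S A d M) (α : ℝ) (D : ℕ) (ξ : ℕ → ℝ) (σsq : Fin M → ℝ)
    (T K N : ℕ) (init : ℤ → EuclideanSpace ℝ (Fin d))
    {Ω : Type*} [mΩ : MeasurableSpace Ω] (μ : Measure Ω) (ℱ : Filtration ℕ mΩ)
    (x : ℕ → Fin M → Fin N → Ω → Fin (T + 1) → S × A)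
    (g : ℕ → Fin M → Ω → EuclideanSpace ℝ (Fin d))
    (θ : ℤ → Ω → EuclideanSpace ℝ (Fin d)) : Prop where
  init_eq : ∀ j ≤ 1, ∀ ω, θ j ω = init j
  grad_init : ∀ m, Measurable[ℱ 1] (g 0 m)
  episode_meas : ∀ k ∈ Finset.Icc 1 K, ∀ m n, Measurable[ℱ (k + 1)] (x k m n)
  /-- Given the past, the `N` episodes (of all learners jointly) at iteration `k` are independent
  and identically distributed, and those of learner `m` have the law of an episode under the policy
  with parameter `θ^k`.  Nothing is assumed about the dependence between the learners: they may
  act independently of each other (`Q` a product) or share the same trajectory. -/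
  episode_law : ∀ k ∈ Finset.Icc 1 K,
    ∃ Q : Kernel (EuclideanSpace ℝ (Fin d)) (Fin M → Fin (T + 1) → S × A),
      (∀ θ' m, (Q θ').map (fun y => y m) = P.episodeLaw T m θ') ∧
      ∀ C : Fin N → Set (Fin M → Fin (T + 1) → S × A), (∀ n, MeasurableSet (C n)) →
        μ⟦{ω | ∀ n, (fun m => x k m n ω) ∈ C n} | ℱ k⟧ =ᵐ[μ]
          fun ω => ∏ n, (Q (θ k ω)).real (C n)
  /-- Learner `m` uploads its fresh gradient if and only if its innovation is large enough;
  otherwise the previously uploaded one is kept. -/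
  grad_step : ∀ k ∈ Finset.Icc 1 K, ∀ m ω,
    g k m ω =
      if 1 / (α ^ 2 * (M : ℝ) ^ 2) *
            ∑ i ∈ Finset.Icc 1 D, ξ i * ‖θ ((k : ℤ) + 1 - i) ω - θ ((k : ℤ) - i) ω‖ ^ 2
            + 6 * σsq m
          ≤ ‖P.batchGrad m (θ k ω) (fun n => x k m n ω) - g (k - 1) m ω‖ ^ 2
      then P.batchGrad m (θ k ω) (fun n => x k m n ω)
      else g (k - 1) m ω
  update : ∀ k ∈ Finset.Icc 1 K, ∀ ω, θ ((k : ℤ) + 1) ω = θ k ω - α • ∑ m, g k m ω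

end DRLProblem

/-! Smoothness. Only the policy depends on the parameter `θ`, so the laws of the first `t + 1` steps
under `θ'` and `θ` have density ratio `exp u`, where `u` is a sum of `t + 1` differences of
log-policies (`lintegral_trajLaw_change`). The bounds on the score and on the Hessian entries give
`‖u'‖ ≤ (t+1) G` and `‖u''‖ ≤ (t+1) d F` for every trajectory. A Taylor estimate of `exp u` under a
fixed measure then proves the log-derivative formula for `E[ℓ_m(s_t, a_t)]` and shows that its
gradient is Lipschitz with constant `ℓbar m * ((t+1)² G² + (t+1) d F)`. No interchange of derivative
and integral is needed. Summing against `γ^t` gives the smoothness constant, and the tail beyond `T`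
gives `sigmaT`.

Concentration. A one-episode G(PO)MDP estimate is bounded and has the truncated gradient as its
mean. A dimension-free Hoeffding inequality in Hilbert space, obtained from `cosh ‖·‖` as an
exponential supermartingale, controls the average of `N` independent copies of the sum over
learners. Only independence in the episode index is used, so dependent learners are allowed. Since
`θ^k` is known before iteration `k`, disintegrating along it transfers the bound to the random
iterate, and a union bound over `K` iterations costs probability `δ` in total.

Descent. Off the exceptional event everything is deterministic. The error of the aggregated gradient
splits into truncation, sampling and laziness. The upload rule bounds the laziness by past squared
steps plus noise, and the weighted sum of past steps in the Lyapunov function is built to cancel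
those steps (`lyapunov_succ_le`). Telescoping gives the rate. For the complexity, each of the three
terms of the rate is made at most `ε / 3`. -/

open Filter Topology

/-! ### Calculus: the descent lemma, Taylor bounds for exponentials, geometric sums. -/

section Analysis

variable {E : Type*} [NormedAddCommGroup E]

/-- The descent lemma: the quadratic upper bound of a function with Lipschitz gradient. -/
theorem le_quadratic_of_lipschitz_gradient [InnerProductSpace ℝ E] [CompleteSpace E]
    {f : E → ℝ} {L : ℝ} (hf : Differentiable ℝ f)
    (hL : ∀ x y, ‖gradient f x - gradient f y‖ ≤ L * ‖x - y‖) (x y : E) :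
    f y ≤ f x + inner ℝ (gradient f x) (y - x) + L / 2 * ‖y - x‖ ^ 2 := by
  set h := y - x with hh
  -- The gap between `f` and its quadratic bound along the segment. The Lipschitz condition makes
  -- its derivative nonpositive on `(0, 1)`, so comparing the endpoints suffices.
  let φ : ℝ → ℝ := fun t => f (x + t • h) - t * inner ℝ (gradient f x) h - L / 2 * t ^ 2 * ‖h‖ ^ 2
  have hφ : ∀ t, HasDerivAt φ
      (inner ℝ (gradient f (x + t • h)) h - inner ℝ (gradient f x) h - L * t * ‖h‖ ^ 2) t := by
    intro t
    have h1 : HasDerivAt (fun t : ℝ => x + t • h) h t := by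
      simpa using ((hasDerivAt_id t).smul_const h).const_add x
    have h2 := ((hf (x + t • h)).hasGradientAt.hasFDerivAt).comp_hasDerivAt t h1
    have h3 := (h2.sub ((hasDerivAt_id t).mul_const (inner ℝ (gradient f x) h))).sub
      ((((hasDerivAt_id t).pow 2).const_mul (L / 2)).mul_const (‖h‖ ^ 2))
    refine h3.congr_deriv ?_
    simp only [InnerProductSpace.toDual_apply_apply, id_eq, Nat.cast_ofNat, Nat.add_one_sub_one,
      pow_one]
    ring
  have hanti : AntitoneOn φ (Set.Icc 0 1) := by
    refine antitoneOn_of_deriv_nonpos (convex_Icc 0 1)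
      (fun t _ => (hφ t).continuousAt.continuousWithinAt)
      (fun t _ => (hφ t).differentiableAt.differentiableWithinAt) ?_
    intro t ht
    rw [interior_Icc] at ht
    rw [(hφ t).deriv, ← inner_sub_left]
    have h1 := real_inner_le_norm (gradient f (x + t • h) - gradient f x) h
    have h2 := hL (x + t • h) x
    rw [add_sub_cancel_left, norm_smul, Real.norm_of_nonneg ht.1.le] at h2
    nlinarith [norm_nonneg h, mul_le_mul_of_nonneg_right h2 (norm_nonneg h)]
  have := hanti (Set.left_mem_Icc.2 zero_le_one) (Set.right_mem_Icc.2 zero_le_one) zero_le_one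
  have hy : x + (1 : ℝ) • h = y := by simp [hh]
  simp only [φ, hy, zero_smul, add_zero] at this
  linarith

/-- A function with local Lipschitz constant close to `C` at small scales is `C`-Lipschitz. -/
theorem norm_sub_le_of_norm_sub_le_mul_exp [NormedSpace ℝ E] {E' : Type*} [NormedAddCommGroup E']
    {f : E → E'} {C c : ℝ}
    (h : ∀ x y, ‖f x - f y‖ ≤ C * ‖x - y‖ * Real.exp (c * ‖x - y‖)) (x y : E) :
    ‖f x - f y‖ ≤ C * ‖x - y‖ := by
  have key : ∀ n : ℕ, ‖f x - f y‖ ≤ C * ‖x - y‖ * Real.exp (c * ‖x - y‖ * ((n : ℝ) + 1)⁻¹) := by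
    intro n
    have hn : (0 : ℝ) < (n : ℝ) + 1 := by positivity
    -- Chaining along `n + 1` equal pieces leaves the linear part unchanged and divides the exponent
    -- by `n + 1`. As `n → ∞` the exponential factor tends to `1`.
    let z : ℕ → E := fun i => x + ((i : ℝ) * ((n : ℝ) + 1)⁻¹) • (y - x)
    have hz : ∀ i, ‖z i - z (i + 1)‖ = ‖x - y‖ * ((n : ℝ) + 1)⁻¹ := by
      intro i
      have : z i - z (i + 1) = ((n : ℝ) + 1)⁻¹ • (x - y) := by
        simp only [z]; push_cast; module
      rw [this, norm_smul, Real.norm_of_nonneg (by positivity), mul_comm]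
    have h0 : z 0 = x := by simp [z]
    have h1 : z (n + 1) = y := by
      simp only [z]; push_cast; rw [mul_inv_cancel₀ hn.ne']; simp
    have hs : f x - f y = ∑ i ∈ Finset.range (n + 1), (f (z i) - f (z (i + 1))) := by
      rw [Finset.sum_range_sub' (fun i => f (z i)), h0, h1]
    rw [hs]
    refine (norm_sum_le _ _).trans ?_
    have : ∀ i ∈ Finset.range (n + 1), ‖f (z i) - f (z (i + 1))‖ ≤
        C * (‖x - y‖ * ((n : ℝ) + 1)⁻¹) * Real.exp (c * ‖x - y‖ * ((n : ℝ) + 1)⁻¹) := by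
      intro i _
      have := h (z i) (z (i + 1))
      rw [hz, ← mul_assoc c] at this
      exact this
    refine (Finset.sum_le_sum this).trans (le_of_eq ?_)
    rw [Finset.sum_const, Finset.card_range, nsmul_eq_mul]
    push_cast
    field_simp
  have hlim : Tendsto (fun n : ℕ => C * ‖x - y‖ * Real.exp (c * ‖x - y‖ * ((n : ℝ) + 1)⁻¹)) atTop
      (𝓝 (C * ‖x - y‖ * Real.exp (c * ‖x - y‖ * 0))) := by
    refine Tendsto.const_mul _ ((Real.continuous_exp.tendsto _).comp (Tendsto.const_mul _ ?_))
    simpa [one_div] using tendsto_one_div_add_atTop_nhds_zero_nat (𝕜 := ℝ)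
  simpa using ge_of_tendsto' hlim key

section Exp

variable [NormedSpace ℝ E] {u : E → ℝ} {a b : ℝ}

theorem exp_le_exp_mul_of_norm_fderiv_le (hu : Differentiable ℝ u)
    (ha : ∀ x, ‖fderiv ℝ u x‖ ≤ a) (x y : E) :
    Real.exp (u y) ≤ Real.exp (a * ‖y - x‖) * Real.exp (u x) := by
  rw [← Real.exp_add, Real.exp_le_exp]
  have := Convex.norm_image_sub_le_of_norm_fderiv_le (𝕜 := ℝ) (s := Set.univ) (f := u) (x := x)
    (y := y) (fun z _ => hu z) (fun z _ => ha z) convex_univ trivial trivial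
  have := (le_abs_self _).trans this
  linarith

/-- The derivative of `exp u • u'` is `exp u • (u'' + u' ⊗ u')`, whose norm is at most `(a² + b) exp
u`. The factor `exp (u x)` is kept explicit: in the application `u` is a log-likelihood ratio that
vanishes at `x`, so the bound does not depend on the trajectory. -/
theorem norm_exp_smul_fderiv_sub_le (hu : Differentiable ℝ u)
    (hu' : Differentiable ℝ (fderiv ℝ u)) (ha : ∀ x, ‖fderiv ℝ u x‖ ≤ a)
    (hb : ∀ x, ‖fderiv ℝ (fderiv ℝ u) x‖ ≤ b) (x y : E) :
    ‖Real.exp (u y) • fderiv ℝ u y - Real.exp (u x) • fderiv ℝ u x‖ ≤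
      (a ^ 2 + b) * ‖y - x‖ * Real.exp (a * ‖y - x‖) * Real.exp (u x) := by
  have ha0 : 0 ≤ a := (norm_nonneg _).trans (ha x)
  have hb0 : 0 ≤ b := le_trans (norm_nonneg (fderiv ℝ (fderiv ℝ u) x)) (hb x)
  have hd : ∀ z, HasFDerivAt (fun z => Real.exp (u z) • fderiv ℝ u z)
      (Real.exp (u z) • fderiv ℝ (fderiv ℝ u) z +
        (Real.exp (u z) • fderiv ℝ u z).smulRight (fderiv ℝ u z)) z := fun z =>
    ((hu z).hasFDerivAt.exp).smul (hu' z).hasFDerivAt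
  -- `exp u` need not be bounded globally, so the mean value inequality is used on the ball of
  -- radius `‖y - x‖`, at the price of `exp (a * ‖y - x‖)`.
  have := Convex.norm_image_sub_le_of_norm_hasFDerivWithin_le (𝕜 := ℝ)
    (s := Metric.closedBall x ‖y - x‖) (x := x) (y := y)
    (C := (a ^ 2 + b) * (Real.exp (a * ‖y - x‖) * Real.exp (u x)))
    (fun z _ => (hd z).hasFDerivWithinAt) ?_ (convex_closedBall _ _) (by simp)
    (by simp [dist_eq_norm])
  · refine this.trans (le_of_eq (by ring))
  · intro z hz
    have hz : ‖z - x‖ ≤ ‖y - x‖ := by simpa [dist_eq_norm] using hz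
    have h1 : Real.exp (u z) ≤ Real.exp (a * ‖y - x‖) * Real.exp (u x) := by
      refine (exp_le_exp_mul_of_norm_fderiv_le hu ha x z).trans ?_
      gcongr
    refine (norm_add_le _ _).trans ?_
    rw [ContinuousLinearMap.norm_smulRight_apply, norm_smul, norm_smul,
      Real.norm_of_nonneg (Real.exp_pos _).le]
    have h2 : Real.exp (u z) * ‖fderiv ℝ (fderiv ℝ u) z‖ + Real.exp (u z) * ‖fderiv ℝ u z‖ *
        ‖fderiv ℝ u z‖ ≤ Real.exp (u z) * b + Real.exp (u z) * a * a := by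
      gcongr
      exacts [hb z, ha z, ha z]
    calc _ ≤ _ := h2
      _ = (a ^ 2 + b) * Real.exp (u z) := by ring
      _ ≤ _ := by gcongr

/-- Mean value inequality for `exp u` minus its linearization at `x`, whose derivative is controlled
by the previous lemma. The factor `1/2` of Taylor's formula is given up, since only the quadratic
order matters. -/
theorem abs_exp_sub_exp_sub_le (hu : Differentiable ℝ u)
    (hu' : Differentiable ℝ (fderiv ℝ u)) (ha : ∀ x, ‖fderiv ℝ u x‖ ≤ a)
    (hb : ∀ x, ‖fderiv ℝ (fderiv ℝ u) x‖ ≤ b) (x y : E) :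
    |Real.exp (u y) - Real.exp (u x) - Real.exp (u x) * fderiv ℝ u x (y - x)| ≤
      (a ^ 2 + b) * ‖y - x‖ ^ 2 * Real.exp (a * ‖y - x‖) * Real.exp (u x) := by
  have ha0 : 0 ≤ a := (norm_nonneg _).trans (ha x)
  have hb0 : 0 ≤ b := le_trans (norm_nonneg (fderiv ℝ (fderiv ℝ u) x)) (hb x)
  have := Convex.norm_image_sub_le_of_norm_hasFDerivWithin_le' (𝕜 := ℝ)
    (s := Metric.closedBall x ‖y - x‖) (x := x) (y := y) (f := fun z => Real.exp (u z))
    (f' := fun z => Real.exp (u z) • fderiv ℝ u z) (φ := Real.exp (u x) • fderiv ℝ u x)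
    (C := (a ^ 2 + b) * ‖y - x‖ * Real.exp (a * ‖y - x‖) * Real.exp (u x))
    (fun z _ => (hu z).hasFDerivAt.exp.hasFDerivWithinAt) ?_ (convex_closedBall _ _) (by simp)
    (by simp [dist_eq_norm])
  · refine (le_of_eq ?_).trans (this.trans (le_of_eq (by ring)))
    simp [Real.norm_eq_abs]
  · intro z hz
    have hz : ‖z - x‖ ≤ ‖y - x‖ := by simpa [dist_eq_norm] using hz
    refine (norm_exp_smul_fderiv_sub_le hu hu' ha hb x z).trans ?_
    gcongr

end Exp

/-- A bilinear form on `ℝ^d` with entries bounded by `F` has norm at most `d F`. -/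
theorem EuclideanSpace.opNorm_le_of_entries_le {d : ℕ}
    (B : EuclideanSpace ℝ (Fin d) →L[ℝ] EuclideanSpace ℝ (Fin d) →L[ℝ] ℝ) {F : ℝ}
    (hB : ∀ i j, |B (EuclideanSpace.single i 1) (EuclideanSpace.single j 1)| ≤ F) :
    ‖B‖ ≤ d * F := by
  have hF : 0 ≤ d * F := by
    rcases Nat.eq_zero_or_pos d with rfl | hd
    · simp
    · exact mul_nonneg d.cast_nonneg ((abs_nonneg _).trans (hB ⟨0, hd⟩ ⟨0, hd⟩))
  have hsum : ∀ v : EuclideanSpace ℝ (Fin d), v = ∑ i, v i • EuclideanSpace.single i (1 : ℝ) := by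
    intro v
    simpa using ((EuclideanSpace.basisFun (Fin d) ℝ).sum_repr v).symm
  -- Cauchy–Schwarz. Using it in both arguments produces the factor `√d * √d = d`.
  have hl1 : ∀ v : EuclideanSpace ℝ (Fin d), ∑ i, |v i| ≤ √d * ‖v‖ := by
    intro v
    rw [EuclideanSpace.norm_eq, ← Real.sqrt_mul d.cast_nonneg]
    refine Real.le_sqrt_of_sq_le ?_
    simpa using sq_sum_le_card_mul_sum_sq (s := Finset.univ) (f := fun i => |v i|)
  refine B.opNorm_le_bound₂ hF fun v w => ?_
  have h1 : B v w = ∑ i, ∑ j, v i * w j *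
      B (EuclideanSpace.single i 1) (EuclideanSpace.single j 1) := by
    conv_lhs => rw [hsum v, hsum w]
    simp only [map_sum, map_smul, sum_apply, smul_apply, smul_eq_mul,
      Finset.mul_sum]
    rw [Finset.sum_comm]
    refine Finset.sum_congr rfl fun i _ => Finset.sum_congr rfl fun j _ => by ring
  rw [h1, Real.norm_eq_abs]
  calc |∑ i, ∑ j, v i * w j * B (EuclideanSpace.single i 1) (EuclideanSpace.single j 1)|
      ≤ ∑ i, ∑ j, |v i| * |w j| * F := by
        refine (Finset.abs_sum_le_sum_abs _ _).trans (Finset.sum_le_sum fun i _ => ?_)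
        refine (Finset.abs_sum_le_sum_abs _ _).trans (Finset.sum_le_sum fun j _ => ?_)
        rw [abs_mul, abs_mul]
        exact mul_le_mul_of_nonneg_left (hB i j) (by positivity)
    _ = (∑ i, |v i|) * (∑ j, |w j|) * F := by
        rw [Finset.sum_mul_sum, Finset.sum_mul]
        exact Finset.sum_congr rfl fun i _ => by rw [Finset.sum_mul]
    _ ≤ (√d * ‖v‖) * (√d * ‖w‖) * F := by
        rcases Nat.eq_zero_or_pos d with rfl | hd
        · simp
        · have hF : 0 ≤ F := (abs_nonneg _).trans (hB ⟨0, hd⟩ ⟨0, hd⟩)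
          gcongr
          exacts [hl1 v, hl1 w]
    _ = d * F * ‖v‖ * ‖w‖ := by
        rw [show (√(d : ℝ) * ‖v‖) * (√(d : ℝ) * ‖w‖) * F = (√d * √d) * F * ‖v‖ * ‖w‖ by ring,
          Real.mul_self_sqrt d.cast_nonneg]

section Geometric

variable {γ : ℝ}

theorem hasSum_geometric_mul_succ (h0 : 0 ≤ γ) (h1 : γ < 1) :
    HasSum (fun t : ℕ => γ ^ t * ((t : ℝ) + 1)) (1 / (1 - γ) ^ 2) := by
  have := hasSum_choose_mul_geometric_of_norm_lt_one (𝕜 := ℝ) 1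
    (r := γ) (by rwa [Real.norm_of_nonneg h0])
  convert! this using 1
  funext t
  rw [Nat.choose_one_right]
  push_cast
  ring

/-- Follows from the binomial series through `(t+1)² = 2 * choose (t+2) 2 - (t+1)`. -/
theorem hasSum_geometric_mul_succ_sq (h0 : 0 ≤ γ) (h1 : γ < 1) :
    HasSum (fun t : ℕ => γ ^ t * ((t : ℝ) + 1) ^ 2)
      ((1 + 2 * γ / (1 - γ)) / (1 - γ) ^ 2) := by
  have h2 := (hasSum_choose_mul_geometric_of_norm_lt_one (𝕜 := ℝ) 2
    (r := γ) (by rwa [Real.norm_of_nonneg h0])).mul_left 2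
  have hne : 1 - γ ≠ 0 := by linarith
  convert! h2.sub (hasSum_geometric_mul_succ h0 h1) using 1
  · funext t
    rw [Nat.cast_choose_two]
    push_cast
    ring
  · field_simp
    ring

theorem hasSum_geometric_mul_succ_tail (h0 : 0 ≤ γ) (h1 : γ < 1) (T : ℕ) :
    HasSum (fun t : ℕ => γ ^ (t + (T + 1)) * (((t + (T + 1) : ℕ) : ℝ) + 1))
      ((T + 1 + 1 / (1 - γ)) * γ ^ (T + 1) / (1 - γ)) := by
  have hne : 1 - γ ≠ 0 := by linarith
  convert! ((hasSum_geometric_mul_succ h0 h1).add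
    ((hasSum_geometric_of_lt_one h0 h1).mul_right ((T : ℝ) + 1))).mul_right (γ ^ (T + 1))
    using 1
  · funext t
    push_cast
    ring
  · field_simp
    ring

end Geometric

end Analysis

theorem hasFDerivAt_of_norm_le_sq_mul_exp {E E' : Type*} [NormedAddCommGroup E] [NormedSpace ℝ E]
    [NormedAddCommGroup E'] [NormedSpace ℝ E'] {f : E → E'} {f' : E →L[ℝ] E'} {x : E} {C c : ℝ}
    (h : ∀ y, ‖f y - f x - f' (y - x)‖ ≤ C * ‖y - x‖ ^ 2 * Real.exp (c * ‖y - x‖)) :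
    HasFDerivAt f f' x := by
  rw [hasFDerivAt_iff_tendsto]
  have hlim : Tendsto (fun y => C * ‖y - x‖ * Real.exp (c * ‖y - x‖)) (𝓝 x) (𝓝 0) := by
    have : Continuous fun y => C * ‖y - x‖ * Real.exp (c * ‖y - x‖) := by fun_prop
    simpa using this.tendsto x
  refine squeeze_zero (fun y => by positivity) (fun y => ?_) hlim
  rcases eq_or_ne y x with rfl | hne
  · simp
  · have hpos : 0 < ‖y - x‖ := norm_pos_iff.2 (sub_ne_zero.2 hne)
    rw [inv_mul_le_iff₀ hpos]
    exact (h y).trans (le_of_eq (by ring))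

/-! ### A dimension-free Hoeffding inequality in Hilbert space. -/

section Concentration

/-- Convexity of `s ↦ cosh √s`. -/
theorem Real.cosh_le_of_sq_le_convexCombination {r p q w : ℝ} (h0 : 0 ≤ w) (h1 : w ≤ 1)
    (h : r ^ 2 ≤ w * p ^ 2 + (1 - w) * q ^ 2) :
    Real.cosh r ≤ w * Real.cosh p + (1 - w) * Real.cosh q := by
  -- In the series `cosh r = ∑ (r²)^n / (2n)!` every term is a monotone convex function of `r²`, so
  -- the comparison is made term by term.
  refine hasSum_le (fun n => ?_) (Real.hasSum_cosh r)
    (((Real.hasSum_cosh p).mul_left w).add ((Real.hasSum_cosh q).mul_left (1 - w)))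
  have h2 := (convexOn_pow n).2 (Set.mem_Ici.2 (sq_nonneg p)) (Set.mem_Ici.2 (sq_nonneg q)) h0
    (sub_nonneg.2 h1) (by ring)
  simp only [smul_eq_mul] at h2
  have h3 : (r ^ 2) ^ n ≤ w * (p ^ 2) ^ n + (1 - w) * (q ^ 2) ^ n :=
    (pow_le_pow_left₀ (sq_nonneg r) h n).trans h2
  simp only [← pow_mul] at h3
  rw [← mul_div_assoc, ← mul_div_assoc, ← add_div]
  gcongr

section Hilbert

variable {H : Type*} [NormedAddCommGroup H] [InnerProductSpace ℝ H]

/-- Writing `⟪v, x⟫ = c ‖v‖ b` with `|c| ≤ 1`, the number `‖v + x‖²` is at most the average of `(‖v‖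
± b)²` with weights `(1 ± c) / 2`; convexity of `cosh √s` and the addition formulas finish. The
point is that the bound is affine in `x`, so its second term integrates to zero for centered `x`. -/
theorem cosh_norm_add_le {v x : H} {b : ℝ} (hx : ‖x‖ ≤ b) :
    Real.cosh ‖v + x‖ ≤ Real.cosh ‖v‖ * Real.cosh b +
      Real.sinh ‖v‖ * Real.sinh b / (‖v‖ * b) * inner ℝ v x := by
  have hb : 0 ≤ b := (norm_nonneg x).trans hx
  have hin : |inner ℝ v x| ≤ ‖v‖ * b :=
    (abs_real_inner_le_norm v x).trans (mul_le_mul_of_nonneg_left hx (norm_nonneg v))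
  -- If `‖v‖ * b = 0`, the inner product vanishes and the quotient is `0` by convention, which is
  -- consistent with the coefficient in the statement.
  obtain ⟨c, hc, hc1⟩ : ∃ c : ℝ, inner ℝ v x = c * (‖v‖ * b) ∧ |c| ≤ 1 ∧
      c = inner ℝ v x / (‖v‖ * b) := by
    refine ⟨inner ℝ v x / (‖v‖ * b), ?_, ?_, rfl⟩
    · rcases eq_or_ne (‖v‖ * b) 0 with h | h
      · rw [h, mul_zero]; rw [h] at hin; exact abs_nonpos_iff.1 hin
      · rw [div_mul_cancel₀ _ h]
    · rw [abs_div, abs_of_nonneg (mul_nonneg (norm_nonneg v) hb)]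
      exact div_le_one_of_le₀ hin (by positivity)
  have hc2 := abs_le.1 hc1.1
  have hsq : ‖v + x‖ ^ 2 ≤ (1 + c) / 2 * (‖v‖ + b) ^ 2 + (1 - (1 + c) / 2) * (‖v‖ - b) ^ 2 := by
    rw [norm_add_sq_real, hc]
    nlinarith [norm_nonneg x]
  refine (Real.cosh_le_of_sq_le_convexCombination (by linarith) (by linarith) hsq).trans
    (le_of_eq ?_)
  rw [Real.cosh_add, Real.cosh_sub, div_mul_eq_mul_div _ (‖v‖ * b), mul_div_assoc _ _ (‖v‖ * b),
    ← hc1.2]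
  ring

variable [MeasurableSpace H] [BorelSpace H] [SecondCountableTopology H]
  {Y : Type*} [MeasurableSpace Y]

theorem lintegral_cosh_norm_add_le [CompleteSpace H] (μ : Measure Y) [IsProbabilityMeasure μ]
    {X : Y → H} {b : ℝ} (hX : Measurable X) (hb : ∀ y, ‖X y‖ ≤ b) (h0 : ∫ y, X y ∂μ = 0) (v : H) :
    ∫⁻ y, ENNReal.ofReal (Real.cosh ‖v + X y‖) ∂μ ≤
      ENNReal.ofReal (Real.cosh ‖v‖ * Real.cosh b) := by
  have hXint : Integrable X μ :=
    Integrable.of_bound hX.aestronglyMeasurable b (Eventually.of_forall hb)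
  set c := Real.sinh ‖v‖ * Real.sinh b / (‖v‖ * b)
  have hin : Integrable (fun y => Real.cosh ‖v‖ * Real.cosh b + c * inner ℝ v (X y)) μ :=
    (integrable_const _).add ((hXint.const_inner v).const_mul c)
  have hle : ∀ y, Real.cosh ‖v + X y‖ ≤ Real.cosh ‖v‖ * Real.cosh b + c * inner ℝ v (X y) :=
    fun y => cosh_norm_add_le (hb y)
  calc ∫⁻ y, ENNReal.ofReal (Real.cosh ‖v + X y‖) ∂μ
      ≤ ∫⁻ y, ENNReal.ofReal (Real.cosh ‖v‖ * Real.cosh b + c * inner ℝ v (X y)) ∂μ :=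
        lintegral_mono fun y => ENNReal.ofReal_le_ofReal (hle y)
    _ = ENNReal.ofReal (∫ y, (Real.cosh ‖v‖ * Real.cosh b + c * inner ℝ v (X y)) ∂μ) :=
        (ofReal_integral_eq_lintegral_ofReal hin
          (Eventually.of_forall fun y => (Real.cosh_pos _).le.trans (hle y))).symm
    _ = _ := by
        rw [integral_add (integrable_const _) ((hXint.const_inner v).const_mul c),
          integral_const_mul c, integral_inner hXint, h0]
        simp

/-- Each centered summand multiplies the expectation of `cosh ‖·‖` by at most `cosh b`. The starting
vector `v` is arbitrary so that the induction can absorb the first summand into it. -/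
theorem lintegral_cosh_norm_sum_le [CompleteSpace H] (μ : Measure Y) [IsProbabilityMeasure μ]
    {X : Y → H} {b : ℝ} (hX : Measurable X) (hb : ∀ y, ‖X y‖ ≤ b) (h0 : ∫ y, X y ∂μ = 0) (N : ℕ)
    (v : H) :
    ∫⁻ y, ENNReal.ofReal (Real.cosh ‖v + ∑ n, X (y n)‖) ∂(Measure.pi fun _ : Fin N => μ) ≤
      ENNReal.ofReal (Real.cosh ‖v‖ * Real.cosh b ^ N) := by
  induction N generalizing v with
  | zero => simp
  | succ N ih =>
    have hmp := (measurePreserving_piFinSuccAbove (fun _ : Fin (N + 1) => μ) 0).symm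
    have hmeas : Measurable fun y : Fin (N + 1) → Y =>
        ENNReal.ofReal (Real.cosh ‖v + ∑ n, X (y n)‖) := by
      refine (Real.continuous_cosh.measurable.comp (Measurable.norm ?_)).ennreal_ofReal
      exact measurable_const.add
        (Finset.measurable_sum _ fun n _ => hX.comp (measurable_pi_apply n))
    rw [← hmp.lintegral_comp hmeas]
    refine (lintegral_prod _ (hmeas.comp hmp.measurable).aemeasurable).trans_le ?_
    calc _ ≤ ∫⁻ y, ENNReal.ofReal (Real.cosh ‖v + X y‖ * Real.cosh b ^ N) ∂μ := by
          refine lintegral_mono fun y => ?_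
          refine (lintegral_congr fun z => ?_).trans_le (ih (v + X y))
          simp [MeasurableEquiv.piFinSuccAbove, Fin.sum_univ_succ, Fin.insertNthEquiv, add_assoc]
      _ = ∫⁻ y, ENNReal.ofReal (Real.cosh ‖v + X y‖) * ENNReal.ofReal (Real.cosh b ^ N) ∂μ := by
          refine lintegral_congr fun y => ENNReal.ofReal_mul (Real.cosh_pos _).le
      _ ≤ ENNReal.ofReal (Real.cosh ‖v‖ * Real.cosh b) * ENNReal.ofReal (Real.cosh b ^ N) := by
          rw [lintegral_mul_const' _ _ ENNReal.ofReal_ne_top]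
          gcongr
          exact lintegral_cosh_norm_add_le μ hX hb h0 v
      _ = _ := by
          rw [← ENNReal.ofReal_mul (mul_pos (Real.cosh_pos _) (Real.cosh_pos _)).le]
          congr 1
          ring

/-- Dimension-free Hoeffding inequality (Pinelis) for i.i.d. bounded centered random vectors of a
Hilbert space. -/
theorem measure_pi_norm_sum_sq_gt_le [CompleteSpace H] (μ : Measure Y) [IsProbabilityMeasure μ]
    {X : Y → H} {b : ℝ} (hX : Measurable X) (hb : ∀ y, ‖X y‖ ≤ b) (h0 : ∫ y, X y ∂μ = 0) {N : ℕ}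
    (hN : 0 < N) {u : ℝ} (hu : 0 ≤ u) :
    (Measure.pi fun _ : Fin N => μ) {y | 2 * u * N * b ^ 2 < ‖∑ n, X (y n)‖ ^ 2} ≤
      ENNReal.ofReal (2 * Real.exp (-u)) := by
  obtain ⟨y₀⟩ : Nonempty Y := μ.nonempty_of_neZero
  have hb0 : 0 ≤ b := (norm_nonneg _).trans (hb y₀)
  have hN' : (0 : ℝ) < N := by exact_mod_cast hN
  -- The tilt parameter below divides by `b`; for `b = 0` the sum vanishes identically.
  rcases hb0.eq_or_lt with rfl | hbpos
  · have : ∀ y, X y = 0 := fun y => norm_le_zero_iff.1 (hb y)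
    simp [this]
  -- The Chernoff choice: for the threshold `r = √(2uN) b` it gives `lam * r = 2u`, while `cosh (lam
  -- b)^N ≤ exp (N (lam b)² / 2) = exp u`. Since `cosh (2u) ≥ exp (2u) / 2`, Markov's inequality
  -- yields `2 exp (-u)`.
  set lam := √(2 * u / N) / b with hlam
  have hlam0 : 0 ≤ lam := by positivity
  have hsqrt : √(2 * u * N) = √(2 * u / N) * N := by
    rw [show 2 * u * N = 2 * u / N * (N * N) by field_simp, Real.sqrt_mul (by positivity),
      Real.sqrt_mul_self hN'.le]
  have hlam2 : N * (lam * b) ^ 2 = 2 * u := by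
    rw [hlam, div_mul_cancel₀ _ hbpos.ne', Real.sq_sqrt (by positivity)]
    field_simp
  have hlamr : lam * (√(2 * u * N) * b) = 2 * u := by
    have : √(2 * u * N) = lam * b * N := by rw [hsqrt, hlam, div_mul_cancel₀ _ hbpos.ne']
    rw [this, ← hlam2]
    ring
  have hmom := lintegral_cosh_norm_sum_le μ (X := fun y => lam • X y) (b := lam * b)
    (hX.const_smul lam) (fun y => by
      rw [norm_smul, Real.norm_of_nonneg hlam0]
      exact mul_le_mul_of_nonneg_left (hb y) hlam0) (by rw [integral_smul, h0, smul_zero]) N 0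
  simp only [zero_add, ← Finset.smul_sum, norm_smul, Real.norm_of_nonneg hlam0, norm_zero,
    Real.cosh_zero, one_mul] at hmom
  have hmeas : Measurable fun y : Fin N → Y =>
      ENNReal.ofReal (Real.cosh (lam * ‖∑ n, X (y n)‖)) := by
    refine (Real.continuous_cosh.measurable.comp (Measurable.const_mul (Measurable.norm ?_)
      lam)).ennreal_ofReal
    exact Finset.measurable_sum _ fun n _ => hX.comp (measurable_pi_apply n)
  have hexp : Real.exp (2 * u) / 2 ≤ Real.cosh (2 * u) := by
    rw [Real.cosh_eq]; gcongr; linarith [Real.exp_pos (-(2 * u))]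
  have hsub : {y : Fin N → Y | 2 * u * N * b ^ 2 < ‖∑ n, X (y n)‖ ^ 2} ⊆
      {y | ENNReal.ofReal (Real.exp (2 * u) / 2) ≤
        ENNReal.ofReal (Real.cosh (lam * ‖∑ n, X (y n)‖))} := by
    intro y hy
    have h1 : √(2 * u * N) * b ≤ ‖∑ n, X (y n)‖ := by
      have : (√(2 * u * N) * b) ^ 2 < ‖∑ n, X (y n)‖ ^ 2 := by
        rw [mul_pow, Real.sq_sqrt (by positivity)]; exact hy
      exact (lt_of_pow_lt_pow_left₀ 2 (norm_nonneg _) this).le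
    refine ENNReal.ofReal_le_ofReal (hexp.trans ?_)
    rw [Real.cosh_le_cosh, abs_of_nonneg (by positivity), abs_of_nonneg (by positivity), ← hlamr]
    gcongr
  refine (measure_mono hsub).trans ?_
  refine (meas_ge_le_lintegral_div hmeas.aemeasurable (by simp [Real.exp_pos])
    ENNReal.ofReal_ne_top).trans ?_
  refine ENNReal.div_le_of_le_mul (hmom.trans ?_)
  rw [← ENNReal.ofReal_mul (by positivity)]
  refine ENNReal.ofReal_le_ofReal ?_
  calc Real.cosh (lam * b) ^ N ≤ Real.exp ((lam * b) ^ 2 / 2) ^ N :=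
        pow_le_pow_left₀ (Real.cosh_pos _).le (Real.cosh_le_exp_half_sq _) N
    _ = Real.exp u := by
        rw [← Real.exp_nat_mul]; congr 1; linarith
    _ = 2 * Real.exp (-u) * (Real.exp (2 * u) / 2) := by
        rw [show 2 * Real.exp (-u) * (Real.exp (2 * u) / 2) = Real.exp (-u) * Real.exp (2 * u)
          by ring, ← Real.exp_add]
        congr 1; ring
    _ ≤ _ := le_rfl

end Hilbert

end Concentration

/-! ### Trajectory laws and change of the policy parameter. -/

namespace ProbabilityTheory.Kernel

open Preorder in
theorem map_eval_zero_trajMeasure {X : ℕ → Type*} [∀ n, MeasurableSpace (X n)]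
    (μ₀ : Measure (X 0)) (κ : (n : ℕ) → Kernel (Π i : Finset.Iic n, X i) (X (n + 1)))
    [∀ n, IsMarkovKernel (κ n)] :
    (trajMeasure μ₀ κ).map (fun x => x 0) = μ₀ := by
  have h : (trajMeasure μ₀ κ).map (frestrictLe 0) = μ₀.map (MeasurableEquiv.piUnique _).symm := by
    rw [trajMeasure, Measure.map_comp _ _ (by fun_prop), traj_map_frestrictLe, partialTraj_self,
      Measure.id_comp]
  have h2 : (fun x : Π n, X n => x 0) =
      (fun h : Π i : Finset.Iic 0, X i => h ⟨0, by simp⟩) ∘ frestrictLe 0 := rfl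
  rw [h2, ← Measure.map_map (by fun_prop) (by fun_prop), h]
  exact (Measure.map_map (measurable_pi_apply _) (MeasurableEquiv.measurable _)).trans
    Measure.map_id

end ProbabilityTheory.Kernel

namespace DRLProblem

variable {S A : Type*} [MeasurableSpace S] [MeasurableSpace A] {d M : ℕ}

local notation "𝔼" => EuclideanSpace ℝ (Fin d)

section Trajectory

variable (P : DRLProblem S A d M)

instance trajLaw_prob (m : Fin M) (θ : 𝔼) : IsProbabilityMeasure (P.trajLaw m θ) := by
  unfold trajLaw; infer_instance

instance episodeLaw_prob (T : ℕ) (m : Fin M) (θ : 𝔼) :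
    IsProbabilityMeasure (P.episodeLaw T m θ) :=
  Measure.isProbabilityMeasure_map
    (measurable_pi_iff.2 fun _ => measurable_pi_apply _).aemeasurable

/-- The logarithm of the density ratio of the policies with parameters `θ'` and `θ`. -/
noncomputable def logRatio (θ θ' : 𝔼) (y : S × A) : ℝ :=
  Real.log (P.π θ' y.1 y.2) - Real.log (P.π θ y.1 y.2)

theorem measurable_pi (θ : 𝔼) : Measurable fun y : S × A => P.π θ y.1 y.2 :=
  P.π_meas.comp (measurable_const.prodMk measurable_id)

theorem measurable_logRatio (θ θ' : 𝔼) : Measurable (P.logRatio θ θ') :=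
  (P.measurable_pi θ').log.sub (P.measurable_pi θ).log

theorem pi_mul_exp_logRatio (θ θ' : 𝔼) (y : S × A) :
    P.π θ y.1 y.2 * Real.exp (P.logRatio θ θ' y) = P.π θ' y.1 y.2 := by
  have h1 := P.π_pos θ y.1 y.2
  rw [logRatio, Real.exp_sub, Real.exp_log (P.π_pos _ _ _), Real.exp_log h1]
  field_simp

/-- Both policies have positive densities with respect to the same `ν`, so the quotient of the
densities is the exponential of `logRatio`. The transition kernel and the initial distribution are
free of `θ`, so the same ratio serves for `step` and for the initial pair. -/
theorem lintegral_policy (θ θ' : 𝔼) (s : S) {f : A → ENNReal} (hf : Measurable f) :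
    ∫⁻ a, f a ∂(P.policy θ' s) =
      ∫⁻ a, f a * ENNReal.ofReal (Real.exp (P.logRatio θ θ' (s, a))) ∂(P.policy θ s) := by
  have hr : Measurable fun a => ENNReal.ofReal (Real.exp (P.logRatio θ θ' (s, a))) :=
    ((P.measurable_logRatio θ θ').comp measurable_prodMk_left).exp.ennreal_ofReal
  have hfr : Measurable fun a => f a * ENNReal.ofReal (Real.exp (P.logRatio θ θ' (s, a))) :=
    hf.mul hr
  rw [policy, policy, Kernel.lintegral_withDensity _ (P.measurable_density θ') _ hf,
    Kernel.lintegral_withDensity _ (P.measurable_density θ) _ hfr]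
  refine lintegral_congr fun a => ?_
  rw [← P.pi_mul_exp_logRatio θ θ' (s, a), ENNReal.ofReal_mul (P.π_pos _ _ _).le]
  ring

theorem lintegral_step (θ θ' : 𝔼) (p : S × A) {f : S × A → ENNReal} (hf : Measurable f) :
    ∫⁻ y, f y ∂(P.step θ' p) =
      ∫⁻ y, f y * ENNReal.ofReal (Real.exp (P.logRatio θ θ' y)) ∂(P.step θ p) := by
  have hr : Measurable fun y => ENNReal.ofReal (Real.exp (P.logRatio θ θ' y)) :=
    (P.measurable_logRatio θ θ').exp.ennreal_ofReal
  have hfr : Measurable fun y => f y * ENNReal.ofReal (Real.exp (P.logRatio θ θ' y)) := hf.mul hr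
  rw [step, step, Kernel.lintegral_compProd _ _ _ hf, Kernel.lintegral_compProd _ _ _ hfr]
  refine lintegral_congr fun s => ?_
  simp only [Kernel.prodMkLeft_apply]
  exact P.lintegral_policy θ θ' s (hf.comp measurable_prodMk_left)

theorem lintegral_init (m : Fin M) (θ θ' : 𝔼) {f : S × A → ENNReal} (hf : Measurable f) :
    ∫⁻ y, f y ∂((P.ρ m) ⊗ₘ (P.policy θ')) =
      ∫⁻ y, f y * ENNReal.ofReal (Real.exp (P.logRatio θ θ' y)) ∂((P.ρ m) ⊗ₘ (P.policy θ)) := by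
  have hr : Measurable fun y => ENNReal.ofReal (Real.exp (P.logRatio θ θ' y)) :=
    (P.measurable_logRatio θ θ').exp.ennreal_ofReal
  have hfr : Measurable fun y => f y * ENNReal.ofReal (Real.exp (P.logRatio θ θ' y)) := hf.mul hr
  rw [Measure.lintegral_compProd hf, Measure.lintegral_compProd hfr]
  exact lintegral_congr fun s => P.lintegral_policy θ θ' s (hf.comp measurable_prodMk_left)

open Preorder

theorem lintegral_trajLaw_zero (m : Fin M) (θ : 𝔼) {f : S × A → ENNReal} (hf : Measurable f) :
    ∫⁻ x, f (x 0) ∂(P.trajLaw m θ) = ∫⁻ y, f y ∂((P.ρ m) ⊗ₘ (P.policy θ)) := by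
  have := Kernel.map_eval_zero_trajMeasure (X := fun _ => S × A) ((P.ρ m) ⊗ₘ (P.policy θ))
    (P.stepHist θ)
  conv_rhs => rw [← this]
  rw [lintegral_map hf (measurable_pi_apply 0)]
  rfl

theorem lintegral_trajLaw_succ (m : Fin M) (θ : 𝔼) (t : ℕ)
    {k : (Π _ : Finset.Iic t, S × A) × (S × A) → ENNReal} (hk : Measurable k) :
    ∫⁻ x, k (frestrictLe t x, x (t + 1)) ∂(P.trajLaw m θ) =
      ∫⁻ x, ∫⁻ y, k (frestrictLe t x, y) ∂(P.step θ (x t)) ∂(P.trajLaw m θ) := by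
  have := Kernel.map_frestrictLe_trajMeasure_compProd_eq_map_trajMeasure (X := fun _ => S × A)
    (μ₀ := (P.ρ m) ⊗ₘ (P.policy θ)) (κ := P.stepHist θ) (a := t)
  have h1 : ∫⁻ x, k (frestrictLe t x, x (t + 1)) ∂(P.trajLaw m θ) =
      ∫⁻ z, k z ∂((P.trajLaw m θ).map
        fun x => ((frestrictLe t x : Π _ : Finset.Iic t, S × A), x (t + 1))) :=
    (lintegral_map hk (by fun_prop)).symm
  rw [h1, trajLaw, ← this, Measure.lintegral_compProd hk,
    lintegral_map hk.lintegral_kernel_prod_right' (by fun_prop)]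
  rfl

/-- Appending an entry to a history. -/
def extendHist {X : Type*} (t : ℕ) (p : (Π _ : Finset.Iic t, X) × X) :
    Π _ : Finset.Iic (t + 1), X :=
  fun i => if h : (i : ℕ) ≤ t then p.1 ⟨i, Finset.mem_Iic.2 h⟩ else p.2

theorem measurable_extendHist {X : Type*} [MeasurableSpace X] (t : ℕ) :
    Measurable (extendHist (X := X) t) := by
  refine measurable_pi_iff.2 fun i => ?_
  unfold extendHist
  split_ifs with h
  · exact (measurable_pi_apply _).comp measurable_fst
  · exact measurable_snd

theorem extendHist_frestrictLe {X : Type*} (t : ℕ) (x : ℕ → X) :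
    extendHist t (frestrictLe (π := fun _ => X) t x, x (t + 1)) = frestrictLe (t + 1) x := by
  funext i
  unfold extendHist
  split_ifs with h
  · rfl
  · have hi : (i : ℕ) = t + 1 := le_antisymm (Finset.mem_Iic.1 i.2) (by omega)
    simp [frestrictLe_apply, hi]

/-- The logarithm of the density ratio of the first `t + 1` steps of a trajectory. -/
noncomputable def logRatioSum (θ θ' : 𝔼) (t : ℕ) (x : ℕ → S × A) : ℝ :=
  ∑ τ ∈ Finset.range (t + 1), P.logRatio θ θ' (x τ)

theorem logRatioSum_eq (θ θ' : 𝔼) (t : ℕ) (x : ℕ → S × A) :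
    P.logRatioSum θ θ' t x =
      ∑ i : Finset.Iic t, P.logRatio θ θ' (frestrictLe (π := fun _ => S × A) t x i) := by
  rw [logRatioSum, Nat.range_succ_eq_Iic]
  exact (Finset.sum_coe_sort (Finset.Iic t) fun i => P.logRatio θ θ' (x i)).symm

/-- Change of the parameter in expectations over the first `t + 1` steps of a trajectory. -/
theorem lintegral_trajLaw_change (m : Fin M) (θ θ' : 𝔼) (t : ℕ)
    {g : (Π _ : Finset.Iic t, S × A) → ENNReal} (hg : Measurable g) :
    ∫⁻ x, g (frestrictLe t x) ∂(P.trajLaw m θ') =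
      ∫⁻ x, g (frestrictLe t x) * ENNReal.ofReal (Real.exp (P.logRatioSum θ θ' t x))
        ∂(P.trajLaw m θ) := by
  induction t with
  | zero =>
    let c : S × A → (Π _ : Finset.Iic 0, S × A) := fun y _ => y
    have hc : Measurable c := measurable_pi_iff.2 fun _ => measurable_id
    have hx : ∀ x : ℕ → S × A, frestrictLe (π := fun _ => S × A) 0 x = c (x 0) := by
      intro x
      funext i
      have : (i : ℕ) = 0 := by simpa using Finset.mem_Iic.1 i.2
      simp [c, frestrictLe_apply, this]
    have hr : Measurable fun y => ENNReal.ofReal (Real.exp (P.logRatio θ θ' y)) :=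
      (P.measurable_logRatio θ θ').exp.ennreal_ofReal
    simp only [hx, logRatioSum, zero_add, Finset.sum_range_one]
    rw [P.lintegral_trajLaw_zero m θ' (f := fun y => g (c y)) (hg.comp hc),
      P.lintegral_trajLaw_zero m θ
        (f := fun y => g (c y) * ENNReal.ofReal (Real.exp (P.logRatio θ θ' y)))
        ((hg.comp hc).mul hr)]
    exact P.lintegral_init m θ θ' (hg.comp hc)
  | succ t ih =>
    let Z : (Π _ : Finset.Iic t, S × A) → ENNReal := fun h =>
      ENNReal.ofReal (Real.exp (∑ i, P.logRatio θ θ' (h i)))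
    have hZ : Measurable Z := (Finset.measurable_sum _ fun i _ =>
      (P.measurable_logRatio θ θ').comp (measurable_pi_apply i)).exp.ennreal_ofReal
    have hr : Measurable fun y => ENNReal.ofReal (Real.exp (P.logRatio θ θ' y)) :=
      (P.measurable_logRatio θ θ').exp.ennreal_ofReal
    let k : (Π _ : Finset.Iic t, S × A) × (S × A) → ENNReal := fun p =>
      g (extendHist t p) * ENNReal.ofReal (Real.exp (P.logRatio θ θ' p.2))
    have hge : Measurable fun p : (Π _ : Finset.Iic t, S × A) × (S × A) => g (extendHist t p) :=
      hg.comp (measurable_extendHist t)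
    have hk : Measurable k := hge.mul (hr.comp measurable_snd)
    -- The last step integrated out, after its own change of parameter. `G` depends on the first `t
    -- + 1` pairs only, so the induction hypothesis changes the parameter of the rest; the step is
    -- then put back under `θ`.
    let G : (Π _ : Finset.Iic t, S × A) → ENNReal := fun h => ∫⁻ y, k (h, y) ∂(P.stepHist θ t h)
    have hG : Measurable G := hk.lintegral_kernel_prod_right'
    calc ∫⁻ x, g (frestrictLe (t + 1) x) ∂(P.trajLaw m θ')
        = ∫⁻ x, g (extendHist t (frestrictLe t x, x (t + 1))) ∂(P.trajLaw m θ') := by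
          simp only [extendHist_frestrictLe]
      _ = ∫⁻ x, ∫⁻ y, g (extendHist t (frestrictLe t x, y)) ∂(P.step θ' (x t))
            ∂(P.trajLaw m θ') := P.lintegral_trajLaw_succ m θ' t hge
      _ = ∫⁻ x, G (frestrictLe t x) ∂(P.trajLaw m θ') :=
          lintegral_congr fun x => P.lintegral_step θ θ' _ (hge.comp measurable_prodMk_left)
      _ = ∫⁻ x, G (frestrictLe t x) * ENNReal.ofReal (Real.exp (P.logRatioSum θ θ' t x))
            ∂(P.trajLaw m θ) := ih hG
      _ = ∫⁻ x, ∫⁻ y, k (frestrictLe t x, y) * Z (frestrictLe t x) ∂(P.step θ (x t))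
            ∂(P.trajLaw m θ) := by
          refine lintegral_congr fun x => ?_
          rw [lintegral_mul_const' _ _ ENNReal.ofReal_ne_top, logRatioSum_eq]
          rfl
      _ = ∫⁻ x, k (frestrictLe t x, x (t + 1)) * Z (frestrictLe t x) ∂(P.trajLaw m θ) :=
          (P.lintegral_trajLaw_succ m θ t (k := fun p => k p * Z p.1)
            (hk.mul (hZ.comp measurable_fst))).symm
      _ = _ := by
          refine lintegral_congr fun x => ?_
          simp only [k, Z, extendHist_frestrictLe, ← logRatioSum_eq]
          rw [mul_assoc, ← ENNReal.ofReal_mul (Real.exp_pos _).le, ← Real.exp_add]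
          congr 3
          rw [logRatioSum, logRatioSum, Finset.sum_range_succ _ (t + 1), add_comm]

theorem measurable_logRatioSum (θ θ' : 𝔼) (t : ℕ) : Measurable (P.logRatioSum θ θ' t) :=
  Finset.measurable_sum _ fun τ _ => (P.measurable_logRatio θ θ').comp (measurable_pi_apply τ)

/-- The likelihood ratio has total mass one: take the constant `1` in the change of parameter. -/
theorem integrable_exp_logRatioSum (m : Fin M) (θ θ' : 𝔼) (t : ℕ) :
    Integrable (fun x => Real.exp (P.logRatioSum θ θ' t x)) (P.trajLaw m θ) := by
  refine ⟨(P.measurable_logRatioSum θ θ' t).exp.aestronglyMeasurable, ?_⟩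
  have := P.lintegral_trajLaw_change m θ θ' t (g := fun _ => 1) measurable_const
  simp only [one_mul, lintegral_one, measure_univ] at this
  rw [hasFiniteIntegral_iff_ofReal (Eventually.of_forall fun _ => (Real.exp_pos _).le), ← this]
  exact ENNReal.one_lt_top

theorem integral_trajLaw_change {E' : Type*} [NormedAddCommGroup E'] [NormedSpace ℝ E']
    [MeasurableSpace E'] [BorelSpace E'] [SecondCountableTopology E']
    (m : Fin M) (θ θ' : 𝔼) (t : ℕ) {g : (Π _ : Finset.Iic t, S × A) → E'} (hg : Measurable g) :
    ∫ x, g (frestrictLe t x) ∂(P.trajLaw m θ') =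
      ∫ x, Real.exp (P.logRatioSum θ θ' t x) • g (frestrictLe t x) ∂(P.trajLaw m θ) := by
  let Z : (Π _ : Finset.Iic t, S × A) → ENNReal := fun h =>
    ENNReal.ofReal (Real.exp (∑ i, P.logRatio θ θ' (h i)))
  have hZ : Measurable Z := (Finset.measurable_sum _ fun i _ =>
    (P.measurable_logRatio θ θ').comp (measurable_pi_apply i)).exp.ennreal_ofReal
  have hr : Measurable (frestrictLe (π := fun _ => S × A) t) := by fun_prop
  -- The `lintegral` identity says that the two laws of the history differ by the density `Z`;
  -- Bochner integrals of vector-valued functions then follow.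
  have hmap : (P.trajLaw m θ').map (frestrictLe t) =
      ((P.trajLaw m θ).map (frestrictLe t)).withDensity Z := by
    refine Measure.ext_of_lintegral _ fun f hf => ?_
    rw [lintegral_map hf hr, lintegral_withDensity_eq_lintegral_mul _ hZ hf,
      lintegral_map (hZ.mul hf) hr, P.lintegral_trajLaw_change m θ θ' t hf]
    refine lintegral_congr fun x => ?_
    simp only [Pi.mul_apply, Z, ← logRatioSum_eq]
    ring
  have hZg : Measurable fun h => (Z h).toReal • g h := hZ.ennreal_toReal.smul hg
  rw [← integral_map (f := g) hr.aemeasurable hg.aestronglyMeasurable, hmap,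
    integral_withDensity_eq_integral_toReal_smul hZ
      (Eventually.of_forall fun _ => ENNReal.ofReal_lt_top),
    integral_map hr.aemeasurable hZg.aestronglyMeasurable]
  refine integral_congr_ae (Eventually.of_forall fun x => ?_)
  simp only [Z, ← logRatioSum_eq, ENNReal.toReal_ofReal (Real.exp_pos _).le]

end Trajectory

end DRLProblem

/-! ### Policy gradients and smoothness of the objective. -/

namespace DRLProblem

variable {S A : Type*} [MeasurableSpace S] [MeasurableSpace A] {d M : ℕ}

local notation "𝔼" => EuclideanSpace ℝ (Fin d)

variable {P : DRLProblem S A d M} {ℓbar : Fin M → ℝ} {G F : ℝ}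

section Score

theorem ScoreBounded.hasGradientAt (hs : P.ScoreBounded G F) (θ : 𝔼) (s : S) (a : A) :
    HasGradientAt (fun θ' => Real.log (P.π θ' s a)) (P.score θ s a) θ :=
  ((hs s a).1 θ).hasGradientAt

/-- Joint measurability in `(θ, s, a)`: each coordinate of the score is a pointwise limit of
difference quotients of the jointly measurable log-density. -/
theorem ScoreBounded.measurable_score (hs : P.ScoreBounded G F) :
    Measurable fun p : 𝔼 × S × A => P.score p.1 p.2.1 p.2.2 := by
  have hlog : Measurable fun p : 𝔼 × S × A => Real.log (P.π p.1 p.2.1 p.2.2) := P.π_meas.log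
  refine measurable_of_tendsto_metrizable
    (f := fun (n : ℕ) (p : 𝔼 × S × A) => ∑ i : Fin d, ((n : ℝ) *
      (Real.log (P.π (p.1 + (n : ℝ)⁻¹ • EuclideanSpace.single i (1 : ℝ)) p.2.1 p.2.2) -
        Real.log (P.π p.1 p.2.1 p.2.2))) • EuclideanSpace.single i (1 : ℝ)) (fun n => ?_) ?_
  · refine Finset.measurable_sum _ fun i _ => Measurable.smul_const (Measurable.const_mul
      (Measurable.sub ?_ hlog) _) _
    exact hlog.comp ((measurable_fst.add_const _).prodMk measurable_snd)
  · rw [tendsto_pi_nhds]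
    intro p
    have hsum : P.score p.1 p.2.1 p.2.2 = ∑ i, (inner ℝ (P.score p.1 p.2.1 p.2.2)
        (EuclideanSpace.single i (1 : ℝ))) • EuclideanSpace.single i (1 : ℝ) := by
      conv_lhs => rw [← (EuclideanSpace.basisFun (Fin d) ℝ).sum_repr (P.score p.1 p.2.1 p.2.2)]
      simp [EuclideanSpace.inner_single_right]
    rw [hsum]
    refine tendsto_finsetSum _ fun i _ => Tendsto.smul_const ?_ _
    have := ((hs.hasGradientAt p.1 p.2.1 p.2.2).hasFDerivAt.lim_real
      (EuclideanSpace.single i (1 : ℝ))).comp tendsto_natCast_atTop_atTop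
    simpa [Function.comp_def] using this

theorem ScoreBounded.norm_score_le (hs : P.ScoreBounded G F)
    (θ : 𝔼) (s : S) (a : A) : ‖P.score θ s a‖ ≤ G :=
  ((hs s a).2.2 θ).1

end Score

/-- The sum `∑_{τ ≤ t} ∇ log π(a_τ | s_τ; θ)` of the scores along a trajectory. -/
noncomputable def scoreSum (P : DRLProblem S A d M) (t : ℕ) (θ : 𝔼) (x : ℕ → S × A) : 𝔼 :=
  ∑ τ ∈ Finset.range (t + 1), P.score θ (x τ).1 (x τ).2

/-- The expected loss `E[ℓ_m(s_t, a_t)]` at time `t`. -/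
noncomputable def lossAt (P : DRLProblem S A d M) (m : Fin M) (t : ℕ) (θ : 𝔼) : ℝ :=
  ∫ x, P.loss m (x t).1 (x t).2 ∂(P.trajLaw m θ)

/-- The gradient of the expected loss at time `t`, by the log-derivative trick. -/
noncomputable def gradAt (P : DRLProblem S A d M) (m : Fin M) (t : ℕ) (θ : 𝔼) : 𝔼 :=
  ∫ x, P.loss m (x t).1 (x t).2 • P.scoreSum t θ x ∂(P.trajLaw m θ)

theorem measurable_loss (m : Fin M) (t : ℕ) :
    Measurable fun x : ℕ → S × A => P.loss m (x t).1 (x t).2 :=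
  (P.loss_meas m).comp (measurable_pi_apply t)

theorem LossBounded.norm_loss_le (hl : P.LossBounded ℓbar) (m : Fin M) (s : S) (a : A) :
    ‖P.loss m s a‖ ≤ ℓbar m := by
  rw [Real.norm_of_nonneg (hl m s a).1]
  exact (hl m s a).2

theorem nonempty_traj (P : DRLProblem S A d M) (m : Fin M) : Nonempty (S × A) := by
  obtain ⟨x⟩ := (P.trajLaw m 0).nonempty_of_neZero
  exact ⟨x 0⟩

theorem LossBounded.nonneg (hl : P.LossBounded ℓbar) (m : Fin M) : 0 ≤ ℓbar m := by
  obtain ⟨y⟩ := P.nonempty_traj m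
  exact (norm_nonneg _).trans (hl.norm_loss_le m y.1 y.2)

theorem ScoreBounded.nonneg (hs : P.ScoreBounded G F) (m : Fin M) : 0 ≤ G := by
  obtain ⟨y⟩ := P.nonempty_traj m
  exact (norm_nonneg _).trans (hs.norm_score_le 0 y.1 y.2)

section Smoothness

theorem ScoreBounded.norm_scoreSum_le (hs : P.ScoreBounded G F) (t : ℕ) (θ : 𝔼) (x : ℕ → S × A) :
    ‖P.scoreSum t θ x‖ ≤ ((t : ℝ) + 1) * G := by
  refine (norm_sum_le_of_le _ fun τ _ => hs.norm_score_le θ _ _).trans (le_of_eq ?_)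
  simp

theorem ScoreBounded.measurable_scoreSum (hs : P.ScoreBounded G F)
    (t : ℕ) (θ : 𝔼) : Measurable (P.scoreSum t θ) :=
  Finset.measurable_sum _ fun τ _ =>
    hs.measurable_score.comp (measurable_const.prodMk (measurable_pi_apply τ))

theorem ScoreBounded.hasFDerivAt_logRatioSum (hs : P.ScoreBounded G F)
    (t : ℕ) (θ θ' : 𝔼) (x : ℕ → S × A) :
    HasFDerivAt (fun θ'' => P.logRatioSum θ θ'' t x)
      (∑ τ ∈ Finset.range (t + 1), fderiv ℝ (fun ϑ => Real.log (P.π ϑ (x τ).1 (x τ).2)) θ') θ' :=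
  HasFDerivAt.fun_sum fun _ _ => ((hs _ _).1 θ').hasFDerivAt.sub_const _

theorem ScoreBounded.fderiv_logRatioSum (hs : P.ScoreBounded G F) (t : ℕ) (θ : 𝔼) (x : ℕ → S × A) :
    fderiv ℝ (fun θ'' => P.logRatioSum θ θ'' t x) = fun θ' =>
      ∑ τ ∈ Finset.range (t + 1), fderiv ℝ (fun ϑ => Real.log (P.π ϑ (x τ).1 (x τ).2)) θ' :=
  funext fun θ' => (hs.hasFDerivAt_logRatioSum t θ θ' x).fderiv

theorem ScoreBounded.fderiv_logRatioSum_eq_toDual (hs : P.ScoreBounded G F)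
    (t : ℕ) (θ θ' : 𝔼) (x : ℕ → S × A) :
    fderiv ℝ (fun θ'' => P.logRatioSum θ θ'' t x) θ' =
      InnerProductSpace.toDual ℝ 𝔼 (P.scoreSum t θ' x) := by
  rw [hs.fderiv_logRatioSum, scoreSum, map_sum]
  exact Finset.sum_congr rfl fun τ _ => (hs.hasGradientAt θ' _ _).hasFDerivAt.fderiv

theorem ScoreBounded.differentiable_logRatioSum (hs : P.ScoreBounded G F)
    (t : ℕ) (θ : 𝔼) (x : ℕ → S × A) :
    Differentiable ℝ (fun θ'' => P.logRatioSum θ θ'' t x) :=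
  fun θ' => (hs.hasFDerivAt_logRatioSum t θ θ' x).differentiableAt

theorem ScoreBounded.differentiable_fderiv_logRatioSum (hs : P.ScoreBounded G F)
    (t : ℕ) (θ : 𝔼) (x : ℕ → S × A) :
    Differentiable ℝ (fderiv ℝ fun θ'' => P.logRatioSum θ θ'' t x) := by
  rw [hs.fderiv_logRatioSum]
  exact Differentiable.fun_sum fun τ _ => (hs _ _).2.1

theorem ScoreBounded.norm_fderiv_logRatioSum_le (hs : P.ScoreBounded G F)
    (t : ℕ) (θ θ' : 𝔼) (x : ℕ → S × A) :
    ‖fderiv ℝ (fun θ'' => P.logRatioSum θ θ'' t x) θ'‖ ≤ ((t : ℝ) + 1) * G := by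
  rw [hs.fderiv_logRatioSum_eq_toDual, LinearIsometryEquiv.norm_map]
  exact hs.norm_scoreSum_le t θ' x

theorem ScoreBounded.norm_fderiv_fderiv_logRatioSum_le (hs : P.ScoreBounded G F)
    (t : ℕ) (θ θ' : 𝔼) (x : ℕ → S × A) :
    ‖fderiv ℝ (fderiv ℝ fun θ'' => P.logRatioSum θ θ'' t x) θ'‖ ≤ ((t : ℝ) + 1) * (d * F) := by
  have h : HasFDerivAt (fderiv ℝ fun θ'' => P.logRatioSum θ θ'' t x)
      (∑ τ ∈ Finset.range (t + 1),
        fderiv ℝ (fderiv ℝ fun ϑ => Real.log (P.π ϑ (x τ).1 (x τ).2)) θ') θ' := by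
    rw [hs.fderiv_logRatioSum]
    exact HasFDerivAt.fun_sum fun τ _ => ((hs _ _).2.1 θ').hasFDerivAt
  rw [h.fderiv]
  have hle : ∀ τ ∈ Finset.range (t + 1),
      ‖fderiv ℝ (fderiv ℝ fun ϑ => Real.log (P.π ϑ (x τ).1 (x τ).2)) θ'‖ ≤ d * F := fun τ _ =>
    EuclideanSpace.opNorm_le_of_entries_le _ ((hs _ _).2.2 θ').2
  have hsum := norm_sum_le (E := 𝔼 →L[ℝ] 𝔼 →L[ℝ] ℝ) (Finset.range (t + 1)) fun τ =>
    fderiv ℝ (fderiv ℝ fun ϑ => Real.log (P.π ϑ (x τ).1 (x τ).2)) θ'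
  refine le_trans hsum (le_trans (Finset.sum_le_sum hle) (le_of_eq ?_))
  simp

theorem logRatioSum_self (t : ℕ) (θ : 𝔼) (x : ℕ → S × A) : P.logRatioSum θ θ t x = 0 := by
  simp [logRatioSum, logRatio]

theorem ScoreBounded.gradAt_change (hs : P.ScoreBounded G F) (m : Fin M) (t : ℕ) (θ θ' : 𝔼) :
    P.gradAt m t θ' = ∫ x, Real.exp (P.logRatioSum θ θ' t x) •
      P.loss m (x t).1 (x t).2 • P.scoreSum t θ' x ∂(P.trajLaw m θ) := by
  let g : (Π _ : Finset.Iic t, S × A) → 𝔼 := fun h =>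
    P.loss m (h ⟨t, by simp⟩).1 (h ⟨t, by simp⟩).2 • ∑ i, P.score θ' (h i).1 (h i).2
  have hg : Measurable g := by
    refine Measurable.smul ((P.loss_meas m).comp (measurable_pi_apply _)) ?_
    exact Finset.measurable_sum _ fun i _ =>
      hs.measurable_score.comp (measurable_const.prodMk (measurable_pi_apply i))
  have hx : ∀ x : ℕ → S × A, P.loss m (x t).1 (x t).2 • P.scoreSum t θ' x =
      g (Preorder.frestrictLe t x) := by
    intro x
    rw [scoreSum, Nat.range_succ_eq_Iic,
      ← Finset.sum_coe_sort (Finset.Iic t) fun i => P.score θ' (x i).1 (x i).2]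
    rfl
  rw [gradAt]
  simp only [hx]
  exact P.integral_trajLaw_change m θ θ' t hg

theorem lossAt_change (m : Fin M) (t : ℕ) (θ θ' : 𝔼) :
    P.lossAt m t θ' = ∫ x, Real.exp (P.logRatioSum θ θ' t x) * P.loss m (x t).1 (x t).2
      ∂(P.trajLaw m θ) :=
  P.integral_trajLaw_change m θ θ' t (g := fun h => P.loss m (h ⟨t, by simp⟩).1 (h ⟨t, by simp⟩).2)
    ((P.loss_meas m).comp (measurable_pi_apply _))

theorem integrable_loss_smul_scoreSum (hs : P.ScoreBounded G F) (hl : P.LossBounded ℓbar)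
    (m : Fin M) (t : ℕ) (θ : 𝔼) (μ : Measure (ℕ → S × A))
    [IsFiniteMeasure μ] : Integrable (fun x => P.loss m (x t).1 (x t).2 • P.scoreSum t θ x) μ := by
  refine Integrable.of_bound ((measurable_loss m t).smul
    (hs.measurable_scoreSum t θ)).aestronglyMeasurable (ℓbar m * (((t : ℝ) + 1) * G))
    (Eventually.of_forall fun x => ?_)
  rw [norm_smul]
  exact mul_le_mul (hl.norm_loss_le m _ _) (hs.norm_scoreSum_le t θ x) (norm_nonneg _) (hl.nonneg m)

theorem LossBounded.integrable_loss (hl : P.LossBounded ℓbar)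
    (m : Fin M) (t : ℕ) (μ : Measure (ℕ → S × A))
    [IsFiniteMeasure μ] : Integrable (fun x => P.loss m (x t).1 (x t).2) μ :=
  Integrable.of_bound (measurable_loss m t).aestronglyMeasurable (ℓbar m)
    (Eventually.of_forall fun _ => hl.norm_loss_le m _ _)

theorem LossBounded.norm_integral_loss_smul_le (hl : P.LossBounded ℓbar)
    {E' : Type*} [NormedAddCommGroup E']
    [NormedSpace ℝ E'] (m : Fin M) (t : ℕ) (μ : Measure (ℕ → S × A)) [IsProbabilityMeasure μ]
    {f : (ℕ → S × A) → E'} {C : ℝ} (hC : ∀ x, ‖f x‖ ≤ C) :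
    ‖∫ x, P.loss m (x t).1 (x t).2 • f x ∂μ‖ ≤ ℓbar m * C := by
  refine (norm_integral_le_of_norm_le_const (C := ℓbar m * C)
    (Eventually.of_forall fun x => ?_)).trans (by simp)
  rw [norm_smul]
  exact mul_le_mul (hl.norm_loss_le m _ _) (hC x) (norm_nonneg _) (hl.nonneg m)

theorem norm_gradAt_le (hs : P.ScoreBounded G F) (hl : P.LossBounded ℓbar)
    (m : Fin M) (t : ℕ) (θ : 𝔼) :
    ‖P.gradAt m t θ‖ ≤ ℓbar m * (((t : ℝ) + 1) * G) :=
  hl.norm_integral_loss_smul_le m t _ fun x => hs.norm_scoreSum_le t θ x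

/-- All expectations are moved to the fixed law at `θ`. The remainder of the log-derivative formula
is then the expected loss times the Taylor remainder of `exp u`, which is quadratic uniformly over
trajectories because `u = 0` at the base point. -/
theorem hasGradientAt_lossAt (hs : P.ScoreBounded G F) (hl : P.LossBounded ℓbar)
    (m : Fin M) (t : ℕ) (θ : 𝔼) :
    HasGradientAt (P.lossAt m t) (P.gradAt m t θ) θ := by
  refine hasGradientAt_iff_hasFDerivAt.2 (hasFDerivAt_of_norm_le_sq_mul_exp
    (C := ℓbar m * ((((t : ℝ) + 1) * G) ^ 2 + ((t : ℝ) + 1) * (d * F)))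
    (c := ((t : ℝ) + 1) * G) fun θ' => ?_)
  have h1 : Integrable (fun x => Real.exp (P.logRatioSum θ θ' t x) * P.loss m (x t).1 (x t).2)
      (P.trajLaw m θ) := (P.integrable_exp_logRatioSum m θ θ' t).mul_bdd
    (measurable_loss m t).aestronglyMeasurable (Eventually.of_forall fun _ => hl.norm_loss_le m _ _)
  have h2 := hl.integrable_loss m t (P.trajLaw m θ)
  have h3 := integrable_loss_smul_scoreSum hs hl m t θ (P.trajLaw m θ)
  have heq : P.lossAt m t θ' - P.lossAt m t θ -
      (InnerProductSpace.toDual ℝ 𝔼 (P.gradAt m t θ)) (θ' - θ) =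
      ∫ x, P.loss m (x t).1 (x t).2 • (Real.exp (P.logRatioSum θ θ' t x) - 1 -
        inner ℝ (P.scoreSum t θ x) (θ' - θ)) ∂(P.trajLaw m θ) := by
    rw [lossAt_change m t θ θ', InnerProductSpace.toDual_apply_apply, real_inner_comm, gradAt,
      ← integral_inner h3, lossAt, ← integral_sub h1 h2,
      ← integral_sub (h1.sub' h2) (h3.const_inner _)]
    refine integral_congr_ae (Eventually.of_forall fun x => ?_)
    simp only [inner_smul_right, smul_eq_mul, real_inner_comm (P.scoreSum t θ x)]
    ring
  rw [heq]
  refine (hl.norm_integral_loss_smul_le m t _ fun x => ?_).trans (le_of_eq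
    (show _ = ℓbar m * (((((t : ℝ) + 1) * G) ^ 2 + ((t : ℝ) + 1) * (d * F)) * ‖θ' - θ‖ ^ 2 *
      Real.exp (((t : ℝ) + 1) * G * ‖θ' - θ‖)) by ring).symm)
  have := abs_exp_sub_exp_sub_le (hs.differentiable_logRatioSum t θ x)
    (hs.differentiable_fderiv_logRatioSum t θ x)
    (fun θ' => hs.norm_fderiv_logRatioSum_le t θ θ' x)
    (fun θ' => hs.norm_fderiv_fderiv_logRatioSum_le t θ θ' x) θ θ'
  rw [logRatioSum_self, hs.fderiv_logRatioSum_eq_toDual] at this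
  simpa using this

/-- Changing the law at `θ'` to that at `θ` bounds the difference up to a factor `exp (c ‖θ' - θ‖)`,
which subdivision of the segment removes. The result is a global Lipschitz constant without second
derivatives of the expectation. -/
theorem norm_gradAt_sub_le (hs : P.ScoreBounded G F) (hl : P.LossBounded ℓbar)
    (m : Fin M) (t : ℕ) (θ₁ θ₂ : 𝔼) :
    ‖P.gradAt m t θ₁ - P.gradAt m t θ₂‖ ≤
      ℓbar m * ((((t : ℝ) + 1) * G) ^ 2 + ((t : ℝ) + 1) * (d * F)) * ‖θ₁ - θ₂‖ := by
  refine norm_sub_le_of_norm_sub_le_mul_exp (c := ((t : ℝ) + 1) * G) (fun θ' θ => ?_) θ₁ θ₂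
  have h1 : Integrable (fun x => Real.exp (P.logRatioSum θ θ' t x) •
      P.loss m (x t).1 (x t).2 • P.scoreSum t θ' x) (P.trajLaw m θ) := by
    refine (P.integrable_exp_logRatioSum m θ θ' t).smul_bdd (ℓbar m * (((t : ℝ) + 1) * G))
      (integrable_loss_smul_scoreSum hs hl m t θ' (P.trajLaw m θ)).aestronglyMeasurable
      (Eventually.of_forall fun x => ?_)
    rw [norm_smul]
    exact mul_le_mul (hl.norm_loss_le m _ _) (hs.norm_scoreSum_le t θ' x) (norm_nonneg _)
      (hl.nonneg m)
  have h3 := integrable_loss_smul_scoreSum hs hl m t θ (P.trajLaw m θ)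
  have heq : P.gradAt m t θ' - P.gradAt m t θ =
      ∫ x, P.loss m (x t).1 (x t).2 • (Real.exp (P.logRatioSum θ θ' t x) • P.scoreSum t θ' x -
        P.scoreSum t θ x) ∂(P.trajLaw m θ) := by
    rw [hs.gradAt_change m t θ θ', gradAt, ← integral_sub h1 h3]
    refine integral_congr_ae (Eventually.of_forall fun x => ?_)
    simp only [smul_sub]
    rw [smul_comm]
  rw [heq]
  refine (hl.norm_integral_loss_smul_le m t _ fun x => ?_).trans (le_of_eq
    (show _ = ℓbar m * (((((t : ℝ) + 1) * G) ^ 2 + ((t : ℝ) + 1) * (d * F)) * ‖θ' - θ‖ *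
      Real.exp (((t : ℝ) + 1) * G * ‖θ' - θ‖)) by ring).symm)
  have := norm_exp_smul_fderiv_sub_le (hs.differentiable_logRatioSum t θ x)
    (hs.differentiable_fderiv_logRatioSum t θ x)
    (fun θ' => hs.norm_fderiv_logRatioSum_le t θ θ' x)
    (fun θ' => hs.norm_fderiv_fderiv_logRatioSum_le t θ θ' x) θ θ'
  rw [logRatioSum_self, hs.fderiv_logRatioSum_eq_toDual, hs.fderiv_logRatioSum_eq_toDual,
    Real.exp_zero, one_smul, mul_one] at this
  rw [← LinearIsometryEquiv.norm_map (InnerProductSpace.toDual ℝ 𝔼), map_sub]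
  simpa using this

theorem LossBounded.cumLoss_eq (hl : P.LossBounded ℓbar) (m : Fin M) (θ : 𝔼) :
    P.cumLoss m θ = ∑' t, P.γ ^ t * P.lossAt m t θ := by
  rw [cumLoss, ← integral_tsum_of_summable_integral_norm]
  · exact tsum_congr fun t => integral_const_mul _ _
  · exact fun t => (hl.integrable_loss m t _).const_mul _
  · refine Summable.of_nonneg_of_le (fun t => integral_nonneg fun x => norm_nonneg _) (fun t => ?_)
      ((summable_geometric_of_lt_one P.γ_pos.le P.γ_lt_one).mul_right (ℓbar m))
    have hγ : 0 ≤ P.γ ^ t := pow_nonneg P.γ_pos.le t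
    have := norm_integral_le_of_norm_le_const (μ := P.trajLaw m θ) (C := P.γ ^ t * ℓbar m)
      (f := fun x => ‖P.γ ^ t * P.loss m (x t).1 (x t).2‖) (Eventually.of_forall fun x => by
        rw [norm_norm, norm_mul, Real.norm_of_nonneg hγ]
        exact mul_le_mul_of_nonneg_left (hl.norm_loss_le m _ _) hγ)
    simpa using (le_abs_self _).trans this

theorem LossBounded.lossAt_mem (hl : P.LossBounded ℓbar) (m : Fin M) (t : ℕ) (θ : 𝔼) :
    0 ≤ P.lossAt m t θ ∧ P.lossAt m t θ ≤ ℓbar m := by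
  refine ⟨integral_nonneg fun x => (hl m _ _).1, ?_⟩
  have := norm_integral_le_of_norm_le_const (μ := P.trajLaw m θ) (C := ℓbar m)
    (f := fun x => P.loss m (x t).1 (x t).2) (Eventually.of_forall fun x => hl.norm_loss_le m _ _)
  simpa [lossAt] using (le_abs_self _).trans this

theorem LossBounded.totalLoss_nonneg (hl : P.LossBounded ℓbar) (θ : 𝔼) : 0 ≤ P.totalLoss θ := by
  refine Finset.sum_nonneg fun m _ => ?_
  rw [hl.cumLoss_eq]
  exact tsum_nonneg fun t => mul_nonneg (pow_nonneg P.γ_pos.le t) (hl.lossAt_mem m t θ).1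

theorem norm_discounted_gradAt_le (hs : P.ScoreBounded G F) (hl : P.LossBounded ℓbar)
    (m : Fin M) (t : ℕ) (θ : 𝔼) :
    ‖P.γ ^ t • P.gradAt m t θ‖ ≤ ℓbar m * G * (P.γ ^ t * ((t : ℝ) + 1)) := by
  have hγ : 0 ≤ P.γ ^ t := pow_nonneg P.γ_pos.le t
  rw [norm_smul, Real.norm_of_nonneg hγ]
  refine (mul_le_mul_of_nonneg_left (norm_gradAt_le hs hl m t θ) hγ).trans (le_of_eq (by ring))

theorem summable_discounted_gradAt (hs : P.ScoreBounded G F) (hl : P.LossBounded ℓbar)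
    (m : Fin M) (θ : 𝔼) :
    Summable fun t => P.γ ^ t • P.gradAt m t θ :=
  Summable.of_norm_bounded
    ((hasSum_geometric_mul_succ P.γ_pos.le P.γ_lt_one).summable.mul_left (ℓbar m * G))
    (norm_discounted_gradAt_le hs hl m · θ)

/-- Termwise differentiation: the gradients of the terms are bounded, uniformly in `θ`, by the
summable `ℓbar m * G * γ^t * (t + 1)`. Convergence of the series itself is needed at one point only,
here `0`. -/
theorem hasGradientAt_cumLoss (hs : P.ScoreBounded G F) (hl : P.LossBounded ℓbar)
    (m : Fin M) (θ : 𝔼) :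
    HasGradientAt (P.cumLoss m) (∑' t, P.γ ^ t • P.gradAt m t θ) θ := by
  have hcum : P.cumLoss m = fun θ => ∑' t, P.γ ^ t * P.lossAt m t θ :=
    funext fun θ => hl.cumLoss_eq m θ
  have hsum := (hasSum_geometric_mul_succ P.γ_pos.le P.γ_lt_one).summable.mul_left (ℓbar m * G)
  have := hasFDerivAt_tsum (𝕜 := ℝ) (f := fun t θ => P.γ ^ t * P.lossAt m t θ)
    (f' := fun t θ => InnerProductSpace.toDual ℝ 𝔼 (P.γ ^ t • P.gradAt m t θ)) (x₀ := 0) hsum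
    (fun t θ => by
      simpa using (hasGradientAt_lossAt hs hl m t θ).hasFDerivAt.const_mul (P.γ ^ t))
    (fun t θ => by
      rw [LinearIsometryEquiv.norm_map]
      exact norm_discounted_gradAt_le hs hl m t θ)
    (Summable.of_nonneg_of_le
      (fun t => mul_nonneg (pow_nonneg P.γ_pos.le t) (hl.lossAt_mem m t 0).1)
      (fun t => mul_le_mul_of_nonneg_left (hl.lossAt_mem m t 0).2 (pow_nonneg P.γ_pos.le t))
      ((summable_geometric_of_lt_one P.γ_pos.le P.γ_lt_one).mul_right (ℓbar m))) θ
  rw [hcum]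
  refine hasGradientAt_iff_hasFDerivAt.2 (this.congr_fderiv ?_)
  exact ((InnerProductSpace.toDual ℝ 𝔼).toContinuousLinearEquiv.map_tsum).symm

theorem hasGradientAt_totalLoss (hs : P.ScoreBounded G F) (hl : P.LossBounded ℓbar) (θ : 𝔼) :
    HasGradientAt P.totalLoss (∑ m, ∑' t, P.γ ^ t • P.gradAt m t θ) θ := by
  refine hasGradientAt_iff_hasFDerivAt.2 ?_
  rw [map_sum]
  exact HasFDerivAt.fun_sum fun m _ => (hasGradientAt_cumLoss hs hl m θ).hasFDerivAt

theorem differentiable_totalLoss (hs : P.ScoreBounded G F) (hl : P.LossBounded ℓbar)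
    : Differentiable ℝ P.totalLoss :=
  fun θ => (hasGradientAt_totalLoss hs hl θ).differentiableAt

theorem gradient_totalLoss (hs : P.ScoreBounded G F) (hl : P.LossBounded ℓbar) (θ : 𝔼) :
    gradient P.totalLoss θ = ∑ m, ∑' t, P.γ ^ t • P.gradAt m t θ :=
  (hasGradientAt_totalLoss hs hl θ).gradient

theorem norm_gradient_totalLoss_sub_le (hs : P.ScoreBounded G F) (hl : P.LossBounded ℓbar)
    (θ₁ θ₂ : 𝔼) :
    ‖gradient P.totalLoss θ₁ - gradient P.totalLoss θ₂‖ ≤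
      P.smoothConst ℓbar G F * ‖θ₁ - θ₂‖ := by
  rw [gradient_totalLoss hs hl, gradient_totalLoss hs hl, ← Finset.sum_sub_distrib]
  have key : ∀ m, ‖(∑' t, P.γ ^ t • P.gradAt m t θ₁) - ∑' t, P.γ ^ t • P.gradAt m t θ₂‖ ≤
      ℓbar m * ((d * F + G ^ 2 + 2 * P.γ * G ^ 2 / (1 - P.γ)) / (1 - P.γ) ^ 2 * ‖θ₁ - θ₂‖) := by
    intro m
    rw [← (summable_discounted_gradAt hs hl m θ₁).tsum_sub (summable_discounted_gradAt hs hl m θ₂)]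
    -- The `(t+1)²` series carries `G²` and produces `G² + 2γG²/(1-γ)`; the `(t+1)` series carries
    -- `d F`. Both come with `1/(1-γ)²`.
    have h1 := ((hasSum_geometric_mul_succ_sq P.γ_pos.le P.γ_lt_one).mul_left
      (ℓbar m * G ^ 2 * ‖θ₁ - θ₂‖)).add ((hasSum_geometric_mul_succ P.γ_pos.le P.γ_lt_one).mul_left
      (ℓbar m * (d * F) * ‖θ₁ - θ₂‖))
    refine (tsum_of_norm_bounded h1 fun t => ?_).trans (le_of_eq ?_)
    · have hγ : 0 ≤ P.γ ^ t := pow_nonneg P.γ_pos.le t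
      rw [← smul_sub, norm_smul, Real.norm_of_nonneg hγ]
      refine (mul_le_mul_of_nonneg_left (norm_gradAt_sub_le hs hl m t θ₁ θ₂) hγ).trans
        (le_of_eq (by ring))
    · have : 1 - P.γ ≠ 0 := (sub_pos.2 P.γ_lt_one).ne'
      field_simp
      ring
  refine (norm_sum_le_of_le _ fun m _ => key m).trans (le_of_eq ?_)
  rw [← Finset.sum_mul, smoothConst]
  ring

/-- The gradient of the loss truncated at the horizon `T`. -/
noncomputable def truncGrad (P : DRLProblem S A d M) (T : ℕ) (m : Fin M) (θ : 𝔼) : 𝔼 :=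
  ∑ t ∈ Finset.range (T + 1), P.γ ^ t • P.gradAt m t θ

theorem norm_gradient_totalLoss_sub_truncGrad_le (hs : P.ScoreBounded G F) (hl : P.LossBounded ℓbar)
    (T : ℕ) (θ : 𝔼) :
    ‖gradient P.totalLoss θ - ∑ m, P.truncGrad T m θ‖ ≤ P.sigmaT ℓbar G T := by
  rw [gradient_totalLoss hs hl, ← Finset.sum_sub_distrib, sigmaT]
  refine norm_sum_le_of_le _ fun m _ => ?_
  rw [truncGrad, ← (summable_discounted_gradAt hs hl m θ).sum_add_tsum_nat_add (T + 1),
    add_sub_cancel_left]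
  refine (tsum_of_norm_bounded ((hasSum_geometric_mul_succ_tail P.γ_pos.le P.γ_lt_one T).mul_left
    (ℓbar m * G)) fun t => norm_discounted_gradAt_le hs hl m _ θ).trans (le_of_eq (by ring))

end Smoothness

end DRLProblem

/-! ### Conditionally i.i.d. draws with a random parameter. -/

section CondLaw

variable {E Y Ω : Type*} [MeasurableSpace E] [MeasurableSpace Y]

/-- The kernel of `N` independent draws from a Markov kernel. -/
noncomputable def ProbabilityTheory.Kernel.iid (Q : Kernel E Y) [IsMarkovKernel Q] (N : ℕ) :
    Kernel E (Fin N → Y) where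
  toFun e := Measure.pi fun _ => Q e
  measurable' := by
    refine Measurable.measure_of_isPiSystem_of_isProbabilityMeasure generateFrom_pi.symm
      isPiSystem_pi ?_
    rintro _ ⟨C, hC, rfl⟩
    simp only [Measure.pi_pi]
    exact Finset.measurable_prod _ fun n _ => Q.measurable_coe (hC n trivial)

theorem ProbabilityTheory.Kernel.iid_apply (Q : Kernel E Y) [IsMarkovKernel Q] (N : ℕ) (e : E) :
    Q.iid N e = Measure.pi fun _ => Q e := rfl

instance (Q : Kernel E Y) [IsMarkovKernel Q] (N : ℕ) : IsMarkovKernel (Q.iid N) :=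
  ⟨fun e => by rw [Kernel.iid_apply]; infer_instance⟩

variable {m mΩ : MeasurableSpace Ω} {μ : Measure Ω} [IsProbabilityMeasure μ] {N : ℕ}
  {ϑ : Ω → E} {W : Ω → Fin N → Y} {Q : Kernel E Y}  [IsMarkovKernel Q]

theorem measure_inter_eq_of_condLaw (hm : m ≤ mΩ) (hϑ : Measurable[m] ϑ)
    (hW : Measurable W) (h : ∀ C : Fin N → Set Y, (∀ n, MeasurableSet (C n)) →
      μ⟦{ω | ∀ n, W ω n ∈ C n} | m⟧ =ᵐ[μ] fun ω => ∏ n, (Q (ϑ ω)).real (C n))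
    {s : Set E} (hs : MeasurableSet s) {C : Fin N → Set Y} (hC : ∀ n, MeasurableSet (C n)) :
    μ (W ⁻¹' (Set.univ.pi C) ∩ ϑ ⁻¹' s) =
      ∫⁻ ω in ϑ ⁻¹' s, Q.iid N (ϑ ω) (Set.univ.pi C) ∂μ := by
  have hϑ' : Measurable ϑ := hϑ.mono hm le_rfl
  have hset : {ω | ∀ n, W ω n ∈ C n} = W ⁻¹' (Set.univ.pi C) := by ext; simp [Set.mem_pi]
  have hCpi : MeasurableSet (Set.univ.pi C) := MeasurableSet.univ_pi hC
  have hmeas : MeasurableSet (W ⁻¹' (Set.univ.pi C)) := hW hCpi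
  have h1 := setIntegral_condExp hm (μ := μ)
    (f := (W ⁻¹' (Set.univ.pi C)).indicator fun _ => (1 : ℝ))
    ((integrable_const 1).indicator hmeas) (hϑ hs)
  have h2 := h C hC
  rw [hset] at h2
  rw [setIntegral_congr_ae (hϑ' hs) (h2.mono fun ω hω _ => hω),
    integral_indicator_const _ hmeas] at h1
  have h3 : ∀ ω, ∏ n, (Q (ϑ ω)).real (C n) = (Q.iid N (ϑ ω) (Set.univ.pi C)).toReal := by
    intro ω
    rw [Kernel.iid_apply, Measure.pi_pi, ENNReal.toReal_prod]
    rfl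
  simp only [h3] at h1
  have h4 : Measurable fun ω => Q.iid N (ϑ ω) (Set.univ.pi C) :=
    ((Q.iid N).measurable_coe hCpi).comp hϑ'
  rw [integral_toReal h4.aemeasurable
    (Eventually.of_forall fun ω => measure_lt_top _ _), smul_eq_mul, mul_one, measureReal_def,
    Measure.restrict_apply hmeas] at h1
  refine ((ENNReal.toReal_eq_toReal_iff' ?_ (measure_ne_top _ _)).1 h1).symm
  refine ne_top_of_le_ne_top (measure_ne_top (μ.restrict (ϑ ⁻¹' s)) Set.univ) ?_
  rw [← lintegral_one]
  exact lintegral_mono fun ω => prob_le_one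

/-- The joint law of `(ϑ, W)` if `W` are independent draws from `Q ϑ`, given the past. -/
theorem map_prodMk_eq_compProd_iid (hm : m ≤ mΩ) (hϑ : Measurable[m] ϑ)
    (hW : Measurable W) (h : ∀ C : Fin N → Set Y, (∀ n, MeasurableSet (C n)) →
      μ⟦{ω | ∀ n, W ω n ∈ C n} | m⟧ =ᵐ[μ] fun ω => ∏ n, (Q (ϑ ω)).real (C n)) :
    μ.map (fun ω => (ϑ ω, W ω)) = (μ.map ϑ) ⊗ₘ (Q.iid N) := by
  have hϑ' : Measurable ϑ := hϑ.mono hm le_rfl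
  have hprob : IsProbabilityMeasure (μ.map ϑ) := Measure.isProbabilityMeasure_map hϑ'.aemeasurable
  -- Two π-system arguments in turn: for fixed `s`, boxes determine the law of `W` on `{ϑ ∈ s}`;
  -- afterwards rectangles `s ×ˢ t` determine the joint law.
  have key : ∀ s : Set E, MeasurableSet s → (μ.restrict (ϑ ⁻¹' s)).map W =
      ((μ.map ϑ).restrict s).bind (Q.iid N) := by
    intro s hs
    have hbind : ∀ t : Set (Fin N → Y), MeasurableSet t →
        ((μ.map ϑ).restrict s).bind (Q.iid N) t = ∫⁻ ω in ϑ ⁻¹' s, Q.iid N (ϑ ω) t ∂μ := by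
      intro t ht
      rw [Measure.bind_apply ht (Q.iid N).aemeasurable,
        setLIntegral_map hs ((Q.iid N).measurable_coe ht) hϑ']
    refine ext_of_generate_finite _ generateFrom_pi.symm isPiSystem_pi ?_ ?_
    · rintro _ ⟨C, hC, rfl⟩
      have hC' : ∀ n, MeasurableSet (C n) := fun n => hC n trivial
      have hCpi : MeasurableSet (Set.univ.pi C) := MeasurableSet.univ_pi hC'
      rw [hbind _ hCpi, Measure.map_apply hW hCpi, Measure.restrict_apply (hW hCpi),
        measure_inter_eq_of_condLaw hm hϑ hW h hs hC']
    · rw [hbind _ MeasurableSet.univ, Measure.map_apply hW MeasurableSet.univ]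
      simp
  refine ext_of_generate_finite _ generateFrom_prod.symm isPiSystem_prod ?_ ?_
  · rintro _ ⟨s, hs, t, ht, rfl⟩
    have hs : MeasurableSet s := hs
    have ht : MeasurableSet t := ht
    have := congrArg (fun ν => ν t) (key s hs)
    rw [Measure.map_apply hW ht, Measure.restrict_apply (hW ht),
      Measure.bind_apply ht (Q.iid N).aemeasurable] at this
    rw [Measure.map_apply (hϑ'.prodMk hW) (hs.prod ht), Measure.compProd_apply_prod hs ht, ← this,
      Set.inter_comm]
    rfl
  · rw [Measure.map_apply (hϑ'.prodMk hW) MeasurableSet.univ]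
    simp

/-- Transfers a tail bound uniform over deterministic parameters to a random parameter known in
advance, by integrating the sections of `B` against the law of `ϑ`. -/
theorem measure_le_of_condLaw (hm : m ≤ mΩ) (hϑ : Measurable[m] ϑ)
    (hW : Measurable W) (h : ∀ C : Fin N → Set Y, (∀ n, MeasurableSet (C n)) →
      μ⟦{ω | ∀ n, W ω n ∈ C n} | m⟧ =ᵐ[μ] fun ω => ∏ n, (Q (ϑ ω)).real (C n))
    {B : Set (E × (Fin N → Y))} (hB : MeasurableSet B) {c : ENNReal}
    (hc : ∀ e, (Measure.pi fun _ : Fin N => Q e) {w | (e, w) ∈ B} ≤ c) :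
    μ {ω | (ϑ ω, W ω) ∈ B} ≤ c := by
  have hϑ' : Measurable ϑ := hϑ.mono hm le_rfl
  have hprob : IsProbabilityMeasure (μ.map ϑ) := Measure.isProbabilityMeasure_map hϑ'.aemeasurable
  calc μ {ω | (ϑ ω, W ω) ∈ B} = μ.map (fun ω => (ϑ ω, W ω)) B :=
        (Measure.map_apply (hϑ'.prodMk hW) hB).symm
    _ = ∫⁻ e, Q.iid N e (Prod.mk e ⁻¹' B) ∂(μ.map ϑ) := by
        rw [map_prodMk_eq_compProd_iid hm hϑ hW h, Measure.compProd_apply hB]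
    _ ≤ ∫⁻ _, c ∂(μ.map ϑ) := lintegral_mono fun e => hc e
    _ = c := by simp

end CondLaw

/-! ### The G(PO)MDP estimator: bound, mean and concentration. -/

namespace DRLProblem

variable {S A : Type*} [MeasurableSpace S] [MeasurableSpace A] {d M : ℕ}

local notation "𝔼" => EuclideanSpace ℝ (Fin d)

variable {P : DRLProblem S A d M} {ℓbar : Fin M → ℝ} {G F : ℝ}

section Estimator

theorem gpomdp_traj (T : ℕ) (m : Fin M) (θ : 𝔼) (x : ℕ → S × A) :
    P.gpomdp T m θ (fun t => x t) = ∑ t ∈ Finset.range (T + 1),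
      P.γ ^ t • P.loss m (x t).1 (x t).2 • P.scoreSum t θ x := by
  rw [gpomdp, ← Fin.sum_univ_eq_sum_range
    (fun t => P.γ ^ t • P.loss m (x t).1 (x t).2 • P.scoreSum t θ x)]
  refine Finset.sum_congr rfl fun t _ => ?_
  rw [scoreSum, Nat.range_succ_eq_Iic, ← Fin.map_valEmbedding_Iic, Finset.sum_map, mul_smul]
  rfl

theorem ScoreBounded.measurable_gpomdp (hs : P.ScoreBounded G F) (T : ℕ) (m : Fin M) :
    Measurable fun p : 𝔼 × (Fin (T + 1) → S × A) => P.gpomdp T m p.1 p.2 := by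
  refine Finset.measurable_sum _ fun t _ => Measurable.fun_smul (Measurable.const_mul ?_ _)
    (Finset.measurable_sum _ fun τ _ => ?_)
  · exact (P.loss_meas m).comp ((measurable_pi_apply t).comp measurable_snd)
  · exact hs.measurable_score.comp
      (measurable_fst.prodMk ((measurable_pi_apply τ).comp measurable_snd))

theorem norm_gpomdp_le (hs : P.ScoreBounded G F) (hl : P.LossBounded ℓbar) (T : ℕ) (m : Fin M)
    (θ : 𝔼) (y : Fin (T + 1) → S × A) :
    ‖P.gpomdp T m θ y‖ ≤ G * ℓbar m / (1 - P.γ) ^ 2 := by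
  have h1 : ∀ t : Fin (T + 1), ‖(P.γ ^ (t : ℕ) * P.loss m (y t).1 (y t).2) •
      ∑ τ ∈ Finset.Iic t, P.score θ (y τ).1 (y τ).2‖ ≤
      G * ℓbar m * (P.γ ^ (t : ℕ) * (((t : ℕ) : ℝ) + 1)) := by
    intro t
    have hγ : 0 ≤ P.γ ^ (t : ℕ) := pow_nonneg P.γ_pos.le t
    have h2 : ‖∑ τ ∈ Finset.Iic t, P.score θ (y τ).1 (y τ).2‖ ≤ (((t : ℕ) : ℝ) + 1) * G := by
      refine (norm_sum_le_of_le _ fun τ _ => hs.norm_score_le θ _ _).trans (le_of_eq ?_)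
      simp
    rw [norm_smul, norm_mul, Real.norm_of_nonneg hγ]
    calc _ ≤ P.γ ^ (t : ℕ) * ℓbar m * ((((t : ℕ) : ℝ) + 1) * G) := by
          refine mul_le_mul (mul_le_mul_of_nonneg_left (hl.norm_loss_le m _ _) hγ) h2
            (norm_nonneg _) (mul_nonneg hγ (hl.nonneg m))
      _ = _ := by ring
  refine (norm_sum_le_of_le _ fun t _ => h1 t).trans ?_
  rw [Fin.sum_univ_eq_sum_range (fun t : ℕ => G * ℓbar m * (P.γ ^ t * ((t : ℝ) + 1))),
    ← Finset.mul_sum, ← mul_one_div]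
  refine mul_le_mul_of_nonneg_left ?_ (mul_nonneg (hs.nonneg m) (hl.nonneg m))
  exact sum_le_hasSum _ (fun t _ => mul_nonneg (pow_nonneg P.γ_pos.le t) (by positivity))
    (hasSum_geometric_mul_succ P.γ_pos.le P.γ_lt_one)

theorem integral_gpomdp (hs : P.ScoreBounded G F) (hl : P.LossBounded ℓbar) (T : ℕ) (m : Fin M)
    (θ : 𝔼) : ∫ y, P.gpomdp T m θ y ∂(P.episodeLaw T m θ) = P.truncGrad T m θ := by
  have hmeas : Measurable (P.gpomdp T m θ) :=
    (hs.measurable_gpomdp T m).comp (measurable_const.prodMk measurable_id)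
  rw [episodeLaw, integral_map (measurable_pi_iff.2 fun _ => measurable_pi_apply _).aemeasurable
    hmeas.aestronglyMeasurable]
  simp only [gpomdp_traj]
  rw [integral_finsetSum _ fun t _ =>
    (integrable_loss_smul_scoreSum hs hl m t θ (P.trajLaw m θ)).fun_smul (P.γ ^ t)]
  exact Finset.sum_congr rfl fun t _ => integral_smul _ _

/-- The estimate and its mean obey the same bound `G * ℓbar m / (1-γ)²`; the triangle inequality
gives the factor `2` in `devBound`. -/
theorem norm_gpomdp_sub_truncGrad_le (hs : P.ScoreBounded G F) (hl : P.LossBounded ℓbar) (T : ℕ)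
    (m : Fin M) (θ : 𝔼) (y : Fin (T + 1) → S × A) :
    ‖P.gpomdp T m θ y - P.truncGrad T m θ‖ ≤ P.devBound ℓbar G m := by
  have h1 := norm_gpomdp_le hs hl T m θ y
  have h2 : ‖P.truncGrad T m θ‖ ≤ G * ℓbar m / (1 - P.γ) ^ 2 := by
    rw [← integral_gpomdp hs hl]
    refine (norm_integral_le_of_norm_le_const (Eventually.of_forall fun y =>
      norm_gpomdp_le hs hl T m θ y)).trans (by simp)
  refine (norm_sub_le _ _).trans ((add_le_add h1 h2).trans (le_of_eq ?_))
  rw [devBound]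
  ring

theorem measurable_truncGrad (hs : P.ScoreBounded G F) (hl : P.LossBounded ℓbar) (T : ℕ)
    (m : Fin M) : Measurable (P.truncGrad T m) := by
  refine Finset.measurable_sum _ fun t _ => Measurable.fun_const_smul (Continuous.measurable ?_) _
  exact (LipschitzWith.of_dist_le' fun θ₁ θ₂ => by
    simpa [dist_eq_norm] using norm_gradAt_sub_le hs hl m t θ₁ θ₂).continuous

/-- Concentration of the sum over the learners of the mini-batch gradient estimates. -/
theorem measure_pi_batchGrad_deviation_le (hs : P.ScoreBounded G F)
    (hl : P.LossBounded ℓbar) {T K N : ℕ} {δ : ℝ} (hK : 0 < K) (hN : 0 < N) (hδ : 0 < δ)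
    (hδ1 : δ < 1) (θ : 𝔼) (ν : Measure (Fin M → Fin (T + 1) → S × A)) [IsProbabilityMeasure ν]
    (hν : ∀ m, ν.map (fun y => y m) = P.episodeLaw T m θ) :
    (Measure.pi fun _ : Fin N => ν) {w | P.sigmaSq ℓbar G N K δ <
        ‖∑ m, P.batchGrad m θ (fun n => w n m) - ∑ m, P.truncGrad T m θ‖ ^ 2} ≤
      ENNReal.ofReal (δ / K) := by
  have hN' : (0 : ℝ) < N := by exact_mod_cast hN
  have hK' : (1 : ℝ) ≤ K := by exact_mod_cast hK
  -- The learners are summed within one episode index, so that Hoeffding applies to vectors i.i.d.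
  -- in `n`. Only the marginals of `ν` enter the mean, and the bound is `∑ V_m`.
  let X : (Fin M → Fin (T + 1) → S × A) → 𝔼 := fun y =>
    ∑ m, (P.gpomdp T m θ (y m) - P.truncGrad T m θ)
  have hg : ∀ m, Measurable (P.gpomdp T m θ) := fun m =>
    (hs.measurable_gpomdp T m).comp (measurable_const.prodMk measurable_id)
  have hX : Measurable X := Finset.measurable_sum _ fun m _ =>
    ((hg m).comp (measurable_pi_apply m)).sub_const _
  have hb : ∀ y, ‖X y‖ ≤ ∑ m, P.devBound ℓbar G m := fun y =>
    norm_sum_le_of_le _ fun m _ => norm_gpomdp_sub_truncGrad_le hs hl T m θ (y m)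
  have hXint : ∀ m, Integrable (fun y : Fin M → Fin (T + 1) → S × A => P.gpomdp T m θ (y m)) ν :=
    fun m => Integrable.of_bound ((hg m).comp (measurable_pi_apply m)).aestronglyMeasurable _
      (Eventually.of_forall fun y => norm_gpomdp_le hs hl T m θ (y m))
  have h0 : ∫ y, X y ∂ν = 0 := by
    rw [integral_finsetSum _ fun m _ => (hXint m).sub' (integrable_const _)]
    refine Finset.sum_eq_zero fun m _ => ?_
    rw [integral_sub (hXint m) (integrable_const _), ← integral_gpomdp hs hl, ← hν m,
      integral_map (measurable_pi_apply m).aemeasurable (hg m).aestronglyMeasurable]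
    simp
  set u := Real.log (2 * K / δ) with hu
  have harg : 1 ≤ 2 * K / δ := by rw [le_div_iff₀ hδ]; linarith
  have hu0 : 0 ≤ u := Real.log_nonneg harg
  have htail := measure_pi_norm_sum_sq_gt_le ν hX hb h0 hN hu0
  have hexp : 2 * Real.exp (-u) = δ / K := by
    rw [Real.exp_neg, hu, Real.exp_log (by linarith)]
    field_simp
  rw [hexp] at htail
  refine (measure_mono fun w hw => ?_).trans htail
  have hw : P.sigmaSq ℓbar G N K δ <
    ‖∑ m, P.batchGrad m θ (fun n => w n m) - ∑ m, P.truncGrad T m θ‖ ^ 2 := hw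
  have hsum : ∑ m, P.batchGrad m θ (fun n => w n m) - ∑ m, P.truncGrad T m θ =
      (N : ℝ)⁻¹ • ∑ n, X (w n) := by
    simp only [X, batchGrad, Finset.sum_sub_distrib, Finset.sum_const, Finset.card_univ,
      Fintype.card_fin, ← Finset.smul_sum, smul_sub]
    rw [Finset.sum_comm, ← Nat.cast_smul_eq_nsmul ℝ, smul_smul, inv_mul_cancel₀ hN'.ne', one_smul]
  -- Cauchy–Schwarz for `(∑ V_m)²`, which explains the factor `M` in `sigmaSq`.
  have hsig : 2 * u * (∑ m, P.devBound ℓbar G m) ^ 2 / N ≤ P.sigmaSq ℓbar G N K δ := by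
    have hcs := sq_sum_le_card_mul_sum_sq (s := Finset.univ) (f := fun m => P.devBound ℓbar G m)
    rw [Finset.card_univ, Fintype.card_fin] at hcs
    calc 2 * u * (∑ m, P.devBound ℓbar G m) ^ 2 / N
        ≤ 2 * u * (M * ∑ m, P.devBound ℓbar G m ^ 2) / N := by gcongr
      _ = P.sigmaSq ℓbar G N K δ := by
          simp only [sigmaSq, sigmaSqLearner]
          rw [← Finset.sum_div, ← Finset.mul_sum, hu]
          ring
  rw [hsum, norm_smul, norm_inv, Real.norm_of_nonneg hN'.le, mul_pow] at hw
  have := hsig.trans_lt hw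
  show 2 * u * N * (∑ m, P.devBound ℓbar G m) ^ 2 < ‖∑ n, X (w n)‖ ^ 2
  rw [div_lt_iff₀ hN'] at this
  calc 2 * u * N * (∑ m, P.devBound ℓbar G m) ^ 2
      = 2 * u * (∑ m, P.devBound ℓbar G m) ^ 2 * N := by ring
    _ < (N : ℝ)⁻¹ ^ 2 * ‖∑ n, X (w n)‖ ^ 2 * N * N := by gcongr
    _ = ‖∑ n, X (w n)‖ ^ 2 := by field_simp

end Estimator

end DRLProblem

/-! ### Measurability of the iterates. -/

namespace DRLProblem

variable {S A : Type*} [MeasurableSpace S] [MeasurableSpace A] {d M : ℕ}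

local notation "𝔼" => EuclideanSpace ℝ (Fin d)

variable {P : DRLProblem S A d M} {ℓbar : Fin M → ℝ} {G F : ℝ}

section Measurability

theorem ScoreBounded.measurable_batchGrad (hs : P.ScoreBounded G F) {Ω : Type*}
    [MeasurableSpace Ω] {N T : ℕ} (m : Fin M) {ϑ : Ω → 𝔼} {x : Fin N → Ω → Fin (T + 1) → S × A}
    (hϑ : Measurable ϑ) (hx : ∀ n, Measurable (x n)) :
    Measurable fun ω => P.batchGrad m (ϑ ω) (fun n => x n ω) := by
  refine Measurable.fun_const_smul (Finset.measurable_sum _ fun n _ => ?_) _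
  exact (hs.measurable_gpomdp T m).comp (hϑ.prodMk (hx n))

theorem measurable_lazyUpdate {Ω : Type*} [MeasurableSpace Ω] {f g : Ω → 𝔼} {c : Ω → ℝ}
    (hf : Measurable f) (hg : Measurable g) (hc : Measurable c) :
    Measurable fun ω => if c ω ≤ ‖f ω - g ω‖ ^ 2 then f ω else g ω :=
  Measurable.ite (measurableSet_le hc ((hf.sub hg).norm.pow_const 2)) hf hg

theorem measurable_gradientStep {Ω : Type*} [MeasurableSpace Ω] {ϑ : Ω → 𝔼} {g : Fin M → Ω → 𝔼}
    (α : ℝ) (hϑ : Measurable ϑ) (hg : ∀ m, Measurable (g m)) :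
    Measurable fun ω => ϑ ω - α • ∑ m, g m ω :=
  hϑ.sub (Measurable.fun_const_smul (Finset.measurable_sum _ fun m _ => hg m) α)

theorem measurable_threshold {Ω : Type*} [MeasurableSpace Ω] {θ : ℤ → Ω → 𝔼} (D : ℕ) (ξ : ℕ → ℝ)
    (c c' : ℝ) (k : ℤ) (hθ : ∀ j ≤ k, Measurable (θ j)) :
    Measurable fun ω =>
      c * ∑ i ∈ Finset.Icc 1 D, ξ i * ‖θ (k + 1 - i) ω - θ (k - i) ω‖ ^ 2 + c' := by
  refine (Measurable.const_mul (Finset.measurable_sum _ fun i hi => ?_) c).add_const c'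
  have hi := Finset.mem_Icc.1 hi
  exact (((hθ _ (by omega)).sub (hθ _ (by omega))).norm.pow_const 2).const_mul _

variable {α : ℝ} {D : ℕ} {ξ : ℕ → ℝ} {σsq : Fin M → ℝ} {T K N : ℕ}
  {init : ℤ → EuclideanSpace ℝ (Fin d)}
  {Ω : Type*} [mΩ : MeasurableSpace Ω] {μ : Measure Ω} {ℱ : Filtration ℕ mΩ}
  {x : ℕ → Fin M → Fin N → Ω → Fin (T + 1) → S × A}
  {g : ℕ → Fin M → Ω → EuclideanSpace ℝ (Fin d)} {θ : ℤ → Ω → EuclideanSpace ℝ (Fin d)}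

/-- The iterate used at iteration `k + 1` is known before that iteration, so the conditional law of
its episodes is taken at a known parameter. Parameters and stored gradients must be treated
together, because each update uses both. -/
theorem IsLAPG.adapted (h : P.IsLAPG α D ξ σsq T K N init μ ℱ x g θ) (hs : P.ScoreBounded G F)
    (k : ℕ) (hk : k ≤ K) :
    (∀ j ≤ (k : ℤ) + 1, Measurable[ℱ (k + 1)] (θ j)) ∧ ∀ m, Measurable[ℱ (k + 1)] (g k m) := by
  induction k with
  | zero =>
    refine ⟨fun j hj => ?_, h.grad_init⟩
    have : θ j = fun _ => init j := funext (h.init_eq j (by simpa using hj))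
    rw [this]
    exact measurable_const
  | succ k ih =>
    obtain ⟨ih1, ih2⟩ := ih (by omega)
    have hmem : k + 1 ∈ Finset.Icc 1 K := Finset.mem_Icc.2 ⟨by omega, hk⟩
    have hmono : ℱ (k + 1) ≤ ℱ (k + 1 + 1) := ℱ.mono (Nat.le_succ _)
    have hθ : ∀ j ≤ (k : ℤ) + 1, Measurable[ℱ (k + 1 + 1)] (θ j) :=
      fun j hj => (ih1 j hj).mono hmono le_rfl
    have hg : ∀ m, Measurable[ℱ (k + 1 + 1)] (g (k + 1) m) := by
      intro m
      rw [funext (h.grad_step (k + 1) hmem m)]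
      refine @measurable_lazyUpdate d Ω (ℱ (k + 1 + 1)) _ _ _
        (@ScoreBounded.measurable_batchGrad S A _ _ d M P G F hs Ω (ℱ (k + 1 + 1)) N T m _ _
          (hθ _ (by push_cast; exact le_rfl)) fun n => h.episode_meas (k + 1) hmem m n)
        ((ih2 m).mono hmono le_rfl) ?_
      exact @measurable_threshold d Ω (ℱ (k + 1 + 1)) θ D ξ _ _ _
        fun j hj => hθ j (by push_cast at hj; exact hj)
    refine ⟨fun j hj => ?_, hg⟩
    rcases hj.lt_or_eq with hj | rfl
    · exact hθ j (by push_cast at hj; omega)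
    · rw [funext (h.update (k + 1) hmem)]
      exact @measurable_gradientStep d M Ω (ℱ (k + 1 + 1)) _ _ α
        (hθ _ (by push_cast; exact le_rfl)) hg

end Measurability

/-! ### Lyapunov descent and the high-probability rate. -/

section Descent

variable {α : ℝ} {D : ℕ} {ξ : ℕ → ℝ} {T K N : ℕ}
  {init : ℤ → EuclideanSpace ℝ (Fin d)}
  {Ω : Type*} [mΩ : MeasurableSpace Ω] {μ : Measure Ω} {ℱ : Filtration ℕ mΩ}
  {x : ℕ → Fin M → Fin N → Ω → Fin (T + 1) → S × A}
  {g : ℕ → Fin M → Ω → EuclideanSpace ℝ (Fin d)} {θ : ℤ → Ω → EuclideanSpace ℝ (Fin d)}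

/-- The total gradient estimate at iteration `k` is within `σ_{N,δ/K}` of its mean, except with
probability `δ / K`. -/
theorem IsLAPG.measure_deviation_le [IsProbabilityMeasure μ] (hM : 0 < M) {σsq : Fin M → ℝ}
    (h : P.IsLAPG α D ξ σsq T K N init μ ℱ x g θ)
    (hs : P.ScoreBounded G F) (hl : P.LossBounded ℓbar) {δ : ℝ} (hN : 0 < N) (hδ : 0 < δ)
    (hδ1 : δ < 1) {k : ℕ} (hk : k ∈ Finset.Icc 1 K) :
    μ {ω | P.sigmaSq ℓbar G N K δ < ‖∑ m, P.batchGrad m (θ k ω) (fun n => x k m n ω) -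
      ∑ m, P.truncGrad T m (θ k ω)‖ ^ 2} ≤ ENNReal.ofReal (δ / K) := by
  obtain ⟨Q, hQ, hC⟩ := h.episode_law k hk
  obtain ⟨hk1, hkK⟩ := Finset.mem_Icc.1 hk
  -- The total mass of `Q` is read off from one marginal, which requires at least one learner.
  have hQp : IsMarkovKernel Q := by
    refine ⟨fun e => ⟨?_⟩⟩
    have := congrArg (fun ν => ν Set.univ) (hQ e ⟨0, hM⟩)
    simpa [Measure.map_apply (measurable_pi_apply (⟨0, hM⟩ : Fin M)) MeasurableSet.univ] using this
  have hθ : Measurable[ℱ k] (θ k) := by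
    obtain ⟨k, rfl⟩ : ∃ k', k = k' + 1 := ⟨k - 1, by omega⟩
    exact (h.adapted hs k (by omega)).1 _ (by push_cast; exact le_rfl)
  have hW : Measurable fun ω (n : Fin N) m => x k m n ω :=
    measurable_pi_iff.2 fun n => measurable_pi_iff.2 fun m =>
      (h.episode_meas k hk m n).mono (ℱ.le _) le_rfl
  let B : Set (𝔼 × (Fin N → Fin M → Fin (T + 1) → S × A)) := {p | P.sigmaSq ℓbar G N K δ <
    ‖∑ m, P.batchGrad m p.1 (fun n => p.2 n m) - ∑ m, P.truncGrad T m p.1‖ ^ 2}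
  have hB : MeasurableSet B := by
    refine measurableSet_lt measurable_const (Measurable.pow_const (Measurable.norm
      (Measurable.sub (Finset.measurable_sum _ fun m _ => ?_)
        (Finset.measurable_sum _ fun m _ => ?_))) 2)
    · exact hs.measurable_batchGrad m measurable_fst fun n =>
        (measurable_pi_apply m).comp ((measurable_pi_apply n).comp measurable_snd)
    · exact (measurable_truncGrad hs hl T m).comp measurable_fst
  exact measure_le_of_condLaw (ℱ.le k) hθ hW hC hB fun e =>
    measure_pi_batchGrad_deviation_le hs hl (by omega) hN hδ hδ1 e (Q e) (hQ e)

theorem norm_sum_sq_le_card_mul {ι E : Type*} [SeminormedAddCommGroup E] (s : Finset ι)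
    (f : ι → E) : ‖∑ i ∈ s, f i‖ ^ 2 ≤ s.card * ∑ i ∈ s, ‖f i‖ ^ 2 :=
  (pow_le_pow_left₀ (norm_nonneg _) (norm_sum_le _ _) 2).trans sq_sum_le_card_mul_sum_sq

theorem norm_add_add_sq_le {E : Type*} [SeminormedAddCommGroup E] (a b c : E) :
    ‖a + b + c‖ ^ 2 ≤ 3 * ‖a‖ ^ 2 + 3 * ‖b‖ ^ 2 + 3 * ‖c‖ ^ 2 := by
  have := norm_sum_sq_le_card_mul Finset.univ ![a, b, c]
  simp [Fin.sum_univ_succ] at this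
  rw [add_assoc]
  linarith

/-- The lazily aggregated gradient differs from the fresh one by at most the threshold. -/
theorem IsLAPG.norm_batchGrad_sub_sq_le (hM : 0 < M) {σsq : Fin M → ℝ} (hσ : ∀ m, 0 ≤ σsq m)
    (h : P.IsLAPG α D ξ σsq T K N init μ ℱ x g θ) (hξ : ∀ i ∈ Finset.Icc 1 D, 0 ≤ ξ i)
    {k : ℕ} (hk : k ∈ Finset.Icc 1 K) (ω : Ω) :
    ‖∑ m, P.batchGrad m (θ k ω) (fun n => x k m n ω) - ∑ m, g k m ω‖ ^ 2 ≤
      1 / α ^ 2 * ∑ i ∈ Finset.Icc 1 D, ξ i * ‖θ ((k : ℤ) + 1 - i) ω - θ ((k : ℤ) - i) ω‖ ^ 2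
        + 6 * (M * ∑ m, σsq m) := by
  have hM' : (0 : ℝ) < M := by exact_mod_cast hM
  set R := ∑ i ∈ Finset.Icc 1 D, ξ i * ‖θ ((k : ℤ) + 1 - i) ω - θ ((k : ℤ) - i) ω‖ ^ 2 with hR
  have hR0 : 0 ≤ R := Finset.sum_nonneg fun i hi => mul_nonneg (hξ i hi) (sq_nonneg _)
  have h1 : ∀ m, ‖P.batchGrad m (θ k ω) (fun n => x k m n ω) - g k m ω‖ ^ 2 ≤
      1 / (α ^ 2 * (M : ℝ) ^ 2) * R + 6 * σsq m := by
    intro m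
    rw [h.grad_step k hk m ω]
    split_ifs with hif
    · have := hσ m
      rw [sub_self, norm_zero, zero_pow two_ne_zero]
      positivity
    · exact (not_le.1 hif).le
  rw [← Finset.sum_sub_distrib]
  refine (norm_sum_sq_le_card_mul _ _).trans ?_
  rw [Finset.card_univ, Fintype.card_fin]
  refine (mul_le_mul_of_nonneg_left (Finset.sum_le_sum fun m _ => h1 m) hM'.le).trans
    (le_of_eq ?_)
  rw [Finset.sum_add_distrib, Finset.sum_const, Finset.card_univ, Fintype.card_fin, nsmul_eq_mul,
    ← Finset.mul_sum, mul_add]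
  congr 1
  -- The `M²` in the threshold cancels against one `M` from Cauchy–Schwarz and one from the sum over
  -- learners. For `α = 0` both sides are `0` by the convention for division.
  · rcases eq_or_ne α 0 with rfl | hα
    · simp
    · field_simp
  · ring

/-- The change of the weighted sum of squared differences in the Lyapunov function. -/
theorem sum_tail_weights_shift (D : ℕ) (ξ : ℕ → ℝ) (a : ℤ → ℝ) (k : ℤ) :
    ∑ i ∈ Finset.Icc 1 D, ∑ τ ∈ Finset.Icc i D, ξ τ * a (k + 1 - i) =
      ∑ i ∈ Finset.Icc 1 D, ∑ τ ∈ Finset.Icc i D, ξ τ * a (k - i) +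
        (∑ τ ∈ Finset.Icc 1 D, ξ τ) * a k - ∑ i ∈ Finset.Icc 1 D, ξ i * a (k - i) := by
  have hswap : ∀ b : ℕ → ℝ, ∑ i ∈ Finset.Icc 1 D, ∑ τ ∈ Finset.Icc i D, ξ τ * b i =
      ∑ τ ∈ Finset.Icc 1 D, ξ τ * ∑ i ∈ Finset.Icc 1 τ, b i := by
    intro b
    simp only [Finset.mul_sum]
    refine Finset.sum_comm' fun i τ => ?_
    simp only [Finset.mem_Icc]
    omega
  -- With the order of summation exchanged, `ξ τ` multiplies a window of `τ` consecutive terms;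
  -- shifting the window gains `a k` and loses `a (k - τ)`.
  rw [hswap fun i => a (k + 1 - i), hswap fun i => a (k - i), Finset.sum_mul,
    ← Finset.sum_add_distrib, ← Finset.sum_sub_distrib]
  refine Finset.sum_congr rfl fun τ hτ => ?_
  have hsh : ∀ n : ℕ, ∑ i ∈ Finset.Icc 1 n, a (k + 1 - i) =
      ∑ i ∈ Finset.Icc 1 n, a (k - i) + a k - a (k - n) := by
    intro n
    induction n with
    | zero => simp
    | succ n ih =>
      rw [Finset.sum_Icc_succ_top (by omega), Finset.sum_Icc_succ_top (by omega), ih]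
      have : k + 1 - ((n + 1 : ℕ) : ℤ) = k - n := by push_cast; ring
      rw [this]
      ring
  rw [hsh τ]
  ring

/-- One-step decrease of the Lyapunov function. -/
theorem lyapunov_succ_le {L : ℝ} (hd : Differentiable ℝ P.totalLoss) (hL0 : 0 < L)
    (hL : ∀ θ₁ θ₂, ‖gradient P.totalLoss θ₁ - gradient P.totalLoss θ₂‖ ≤ L * ‖θ₁ - θ₂‖)
    (hα : 0 < α) (hαL : α ≤ (1 - 3 * ∑ i ∈ Finset.Icc 1 D, ξ i) / L) (ϑ : ℤ → 𝔼) (k : ℤ) (v : 𝔼)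
    (hstep : ϑ (k + 1) = ϑ k - α • v) {e : ℝ}
    (herr : ‖gradient P.totalLoss (ϑ k) - v‖ ^ 2 ≤
      3 / α ^ 2 * ∑ i ∈ Finset.Icc 1 D, ξ i * ‖ϑ (k + 1 - i) - ϑ (k - i)‖ ^ 2 + e) :
    P.lyapunov α D ξ ϑ (k + 1) ≤ P.lyapunov α D ξ ϑ k
      - α / 2 * ‖gradient P.totalLoss (ϑ k)‖ ^ 2 + α / 2 * e := by
  set w := gradient P.totalLoss (ϑ k) with hw
  have hdesc := le_quadratic_of_lipschitz_gradient hd hL (ϑ k) (ϑ (k + 1))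
  have hdiff : ϑ (k + 1) - ϑ k = -(α • v) := by rw [hstep]; abel
  have hshift := sum_tail_weights_shift D ξ (fun j => ‖ϑ (j + 1) - ϑ j‖ ^ 2) k
  have e1 : ∀ i : ℕ, k + 1 - (i : ℤ) + 1 = k + 1 + 1 - i := fun i => by ring
  have e2 : ∀ i : ℕ, k - (i : ℤ) + 1 = k + 1 - i := fun i => by ring
  simp only [e1, e2] at hshift
  rw [hdiff, norm_neg, norm_smul, Real.norm_of_nonneg hα.le] at hshift
  rw [hdiff, inner_neg_right, inner_smul_right, norm_neg, norm_smul,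
    Real.norm_of_nonneg hα.le] at hdesc
  set R := ∑ i ∈ Finset.Icc 1 D, ξ i * ‖ϑ (k + 1 - i) - ϑ (k - i)‖ ^ 2
  set Ξ := ∑ i ∈ Finset.Icc 1 D, ξ i
  simp only [lyapunov]
  rw [hshift]
  -- Polarization turns `-α⟪w, v⟫ + L α²‖v‖²/2` into `-α‖w‖²/2 + α‖w - v‖²/2 - α(1 - αL)‖v‖²/2`. The
  -- past steps in the bound for `‖w - v‖²` cancel those lost in the shift, and the new step
  -- `3αΞ‖v‖²/2` is absorbed because `αL ≤ 1 - 3Ξ`.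
  have hpol := norm_sub_sq_real w v
  have hcoef : α * L ≤ 1 - 3 * Ξ := by rwa [le_div_iff₀ hL0] at hαL
  set I := inner ℝ w v
  have h1 : α / 2 * ‖w - v‖ ^ 2 ≤ 3 / (2 * α) * R + α / 2 * e := by
    refine (mul_le_mul_of_nonneg_left herr (by positivity)).trans (le_of_eq ?_)
    field_simp
  have h2 : 3 / (2 * α) * (Ξ * (α * ‖v‖) ^ 2) = 3 / 2 * α * Ξ * ‖v‖ ^ 2 := by
    field_simp
  have h3 : α / 2 * ‖v‖ ^ 2 * (α * L) ≤ α / 2 * ‖v‖ ^ 2 * (1 - 3 * Ξ) := by gcongr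
  rw [hpol] at h1
  rw [mul_sub, mul_add, h2]
  nlinarith [h1, h3, hdesc]

theorem lyapunov_nonneg (hl : P.LossBounded ℓbar) (hα : 0 < α)
    (hξ : ∀ i ∈ Finset.Icc 1 D, 0 ≤ ξ i) (ϑ : ℤ → 𝔼) (k : ℤ) : 0 ≤ P.lyapunov α D ξ ϑ k := by
  -- The real infimum is a lower bound only for a set bounded below; nonnegative losses guarantee
  -- this.
  have hbdd : BddBelow (Set.range P.totalLoss) :=
    ⟨0, by rintro _ ⟨θ, rfl⟩; exact hl.totalLoss_nonneg θ⟩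
  have h1 := ciInf_le hbdd (ϑ k)
  have h2 : 0 ≤ ∑ i ∈ Finset.Icc 1 D, ∑ τ ∈ Finset.Icc i D,
      ξ τ * ‖ϑ (k + 1 - i) - ϑ (k - i)‖ ^ 2 := by
    refine Finset.sum_nonneg fun i hi => Finset.sum_nonneg fun τ hτ =>
      mul_nonneg (hξ τ ?_) (sq_nonneg _)
    rw [Finset.mem_Icc] at *
    omega
  have h3 : 0 ≤ 3 / (2 * α) := by positivity
  rw [lyapunov]
  have := mul_nonneg h3 h2
  linarith

theorem sum_norm_gradient_sq_le {L : ℝ} (hl : P.LossBounded ℓbar)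
    (hd : Differentiable ℝ P.totalLoss) (hL0 : 0 < L)
    (hL : ∀ θ₁ θ₂, ‖gradient P.totalLoss θ₁ - gradient P.totalLoss θ₂‖ ≤ L * ‖θ₁ - θ₂‖)
    (hξ : ∀ i ∈ Finset.Icc 1 D, 0 ≤ ξ i) (hα : 0 < α)
    (hαL : α ≤ (1 - 3 * ∑ i ∈ Finset.Icc 1 D, ξ i) / L) (ϑ : ℤ → 𝔼) (v : ℕ → 𝔼) {e : ℝ} (K : ℕ)
    (hstep : ∀ k ∈ Finset.Icc 1 K, ϑ ((k : ℤ) + 1) = ϑ k - α • v k)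
    (herr : ∀ k ∈ Finset.Icc 1 K, ‖gradient P.totalLoss (ϑ k) - v k‖ ^ 2 ≤
      3 / α ^ 2 * ∑ i ∈ Finset.Icc 1 D, ξ i * ‖ϑ ((k : ℤ) + 1 - i) - ϑ ((k : ℤ) - i)‖ ^ 2 + e) :
    ∑ k ∈ Finset.Icc 1 K, ‖gradient P.totalLoss (ϑ k)‖ ^ 2 ≤
      2 / α * P.lyapunov α D ξ ϑ 1 + K * e := by
  have key : ∀ n ≤ K, α / 2 * ∑ k ∈ Finset.Icc 1 n, ‖gradient P.totalLoss (ϑ k)‖ ^ 2 ≤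
      P.lyapunov α D ξ ϑ 1 - P.lyapunov α D ξ ϑ ((n : ℤ) + 1) + α / 2 * (n * e) := by
    intro n hn
    induction n with
    | zero => simp
    | succ n ih =>
      have hmem : n + 1 ∈ Finset.Icc 1 K := Finset.mem_Icc.2 ⟨by omega, hn⟩
      have h1 := lyapunov_succ_le hd hL0 hL hα hαL ϑ ((n + 1 : ℕ) : ℤ) (v (n + 1))
        (hstep _ hmem) (herr _ hmem)
      have h2 := ih (by omega)
      rw [Finset.sum_Icc_succ_top (by omega), mul_add]
      push_cast at h1 h2 ⊢
      linarith
  have h1 := key K le_rfl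
  have h2 := lyapunov_nonneg hl hα hξ ϑ ((K : ℤ) + 1)
  have h3 : α / 2 * ∑ k ∈ Finset.Icc 1 K, ‖gradient P.totalLoss (ϑ k)‖ ^ 2 ≤
      α / 2 * (2 / α * P.lyapunov α D ξ ϑ 1 + K * e) := by
    have : α / 2 * (2 / α * P.lyapunov α D ξ ϑ 1 + K * e) =
        P.lyapunov α D ξ ϑ 1 + α / 2 * (K * e) := by field_simp
    linarith
  exact le_of_mul_le_mul_left h3 (by positivity)

theorem sigmaSqLearner_nonneg {δ : ℝ} (hK : 0 < K) (hδ : 0 < δ) (hδ1 : δ < 1) (m : Fin M) :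
    0 ≤ P.sigmaSqLearner ℓbar G N K δ m := by
  have hK' : (1 : ℝ) ≤ K := by exact_mod_cast hK
  have : 0 ≤ Real.log (2 * K / δ) := Real.log_nonneg (by rw [le_div_iff₀ hδ]; linarith)
  unfold sigmaSqLearner
  positivity

/-- Convergence rate of LAPG, with high probability. -/
theorem IsLAPG.rate [IsProbabilityMeasure μ] (hM : 0 < M) (hs : P.ScoreBounded G F)
    (hl : P.LossBounded ℓbar) {L : ℝ} (hL0 : 0 < L)
    (hL : ∀ θ₁ θ₂, ‖gradient P.totalLoss θ₁ - gradient P.totalLoss θ₂‖ ≤ L * ‖θ₁ - θ₂‖)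
    (hξ : ∀ i ∈ Finset.Icc 1 D, 0 ≤ ξ i) (hα : 0 < α)
    (hαL : α ≤ (1 - 3 * ∑ i ∈ Finset.Icc 1 D, ξ i) / L) {δ : ℝ} (hK : 0 < K) (hN : 0 < N)
    (hδ : 0 < δ) (hδ1 : δ < 1)
    (h : P.IsLAPG α D ξ (P.sigmaSqLearner ℓbar G N K δ) T K N init μ ℱ x g θ) :
    1 - δ ≤ μ.real {ω | (1 / (K : ℝ)) *
        ∑ k ∈ Finset.Icc 1 K, ‖gradient P.totalLoss (θ k ω)‖ ^ 2 ≤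
      P.rateBound ℓbar G α D ξ init T K N δ} := by
  have hK' : (0 : ℝ) < K := by exact_mod_cast hK
  set good := {ω | (1 / (K : ℝ)) *
        ∑ k ∈ Finset.Icc 1 K, ‖gradient P.totalLoss (θ k ω)‖ ^ 2 ≤
      P.rateBound ℓbar G α D ξ init T K N δ} with hgood
  let bad : ℕ → Set Ω := fun k => {ω | P.sigmaSq ℓbar G N K δ <
    ‖∑ m, P.batchGrad m (θ k ω) (fun n => x k m n ω) - ∑ m, P.truncGrad T m (θ k ω)‖ ^ 2}
  have hsub : goodᶜ ⊆ ⋃ k ∈ Finset.Icc 1 K, bad k := by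
    intro ω hω
    by_contra hnot
    simp only [Set.mem_iUnion, not_exists] at hnot
    refine hω ?_
    have hdev : ∀ k ∈ Finset.Icc 1 K, ‖∑ m, P.batchGrad m (θ k ω) (fun n => x k m n ω) -
        ∑ m, P.truncGrad T m (θ k ω)‖ ^ 2 ≤ P.sigmaSq ℓbar G N K δ :=
      fun k hk => not_lt.1 (hnot k hk)
    have hsum := sum_norm_gradient_sq_le hl (differentiable_totalLoss hs hl) hL0 hL hξ hα hαL
      (fun j => θ j ω) (fun k => ∑ m, g k m ω)
      (e := 3 * P.sigmaT ℓbar G T ^ 2 + 21 * P.sigmaSq ℓbar G N K δ) K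
      (fun k hk => h.update k hk ω) ?_
    · have hV : P.lyapunov α D ξ (fun j => θ j ω) 1 = P.lyapunov α D ξ init 1 := by
        simp only [lyapunov]
        rw [h.init_eq 1 le_rfl ω]
        congr 2
        refine Finset.sum_congr rfl fun i hi => Finset.sum_congr rfl fun τ _ => ?_
        have hi := Finset.mem_Icc.1 hi
        rw [h.init_eq _ (by omega) ω, h.init_eq _ (by omega) ω]
      rw [hV] at hsum
      show 1 / (K : ℝ) * _ ≤ _
      refine (mul_le_mul_of_nonneg_left hsum (by positivity)).trans (le_of_eq ?_)
      rw [rateBound]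
      field_simp
      ring
    · intro k hk
      have hlazy := h.norm_batchGrad_sub_sq_le hM
        (fun m => sigmaSqLearner_nonneg hK hδ hδ1 m) hξ hk ω
      have htrunc := pow_le_pow_left₀ (norm_nonneg _)
        (norm_gradient_totalLoss_sub_truncGrad_le hs hl T (θ k ω)) 2
      have hdev := hdev k hk
      rw [← norm_neg, neg_sub] at hdev
      -- Truncation, sampling and laziness, each with factor `3`. The noise terms add up to `3 σ_T²
      -- + 3 σ² + 3 * 6 σ² = 3 σ_T² + 21 σ²`.
      have h3 := norm_add_add_sq_le (gradient P.totalLoss (θ k ω) - ∑ m, P.truncGrad T m (θ k ω))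
        (∑ m, P.truncGrad T m (θ k ω) - ∑ m, P.batchGrad m (θ k ω) (fun n => x k m n ω))
        (∑ m, P.batchGrad m (θ k ω) (fun n => x k m n ω) - ∑ m, g k m ω)
      simp only [sub_add_sub_cancel] at h3
      have h4 : 3 / α ^ 2 = 3 * (1 / α ^ 2) := by ring
      have hsig : P.sigmaSq ℓbar G N K δ = M * ∑ m, P.sigmaSqLearner ℓbar G N K δ m := rfl
      rw [← hsig] at hlazy
      rw [h4, mul_assoc]
      linarith
  have hmeas : μ goodᶜ ≤ ENNReal.ofReal δ := by
    calc μ goodᶜ ≤ μ (⋃ k ∈ Finset.Icc 1 K, bad k) := measure_mono hsub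
      _ ≤ ∑ k ∈ Finset.Icc 1 K, μ (bad k) := measure_biUnion_finset_le _ _
      _ ≤ ∑ k ∈ Finset.Icc 1 K, ENNReal.ofReal (δ / K) := Finset.sum_le_sum fun k hk =>
          h.measure_deviation_le hM hs hl hN hδ hδ1 hk
      _ = ENNReal.ofReal δ := by
          rw [Finset.sum_const, Nat.card_Icc, nsmul_eq_mul, ← ENNReal.ofReal_natCast,
            ← ENNReal.ofReal_mul (by positivity)]
          congr 1
          simp only [Nat.add_sub_cancel]
          field_simp
  -- Subadditivity suffices to pass to the complement, so measurability of the good event is not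
  -- needed.
  have h1 : (1 : ENNReal) ≤ μ good + μ goodᶜ := by
    rw [← measure_univ (μ := μ), ← Set.union_compl_self good]
    exact measure_union_le _ _
  have h2 : (1 : ℝ) ≤ μ.real good + μ.real goodᶜ := by
    have := ENNReal.toReal_mono (by finiteness) h1
    rwa [ENNReal.toReal_add (by finiteness) (by finiteness), ENNReal.toReal_one] at this
  have h3 : μ.real goodᶜ ≤ δ := ENNReal.toReal_le_of_le_ofReal hδ.le hmeas
  linarith

end Descent

end DRLProblem

/-! ### Orders of horizon, iterations and batch size. -/

namespace DRLProblem

variable {S A : Type*} [MeasurableSpace S] [MeasurableSpace A] {d M : ℕ}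

variable {P : DRLProblem S A d M} {ℓbar : Fin M → ℝ} {G F : ℝ}

section Complexity

/-- The square contains `γ^(2T)`: one factor `γ^T` absorbs the polynomial `(T+1)²`, since each term
of a convergent nonnegative series is at most its sum `W`, and the other survives. -/
theorem exists_sigmaT_sq_le (P : DRLProblem S A d M) (ℓbar : Fin M → ℝ) (G : ℝ) :
    ∃ C : ℝ, 0 ≤ C ∧ ∀ T : ℕ, 3 * P.sigmaT ℓbar G T ^ 2 ≤ C * P.γ ^ T := by
  have hγ0 := P.γ_pos
  have hγ1 : 0 < 1 - P.γ := sub_pos.2 P.γ_lt_one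
  set c := 1 / (1 - P.γ) with hc
  have hc0 : 0 < c := by positivity
  set B := ∑ m, G * ℓbar m
  have hsq := hasSum_geometric_mul_succ_sq P.γ_pos.le P.γ_lt_one
  set W := (1 + 2 * P.γ / (1 - P.γ)) / (1 - P.γ) ^ 2
  have hterm : ∀ t : ℕ, P.γ ^ t * ((t : ℝ) + 1) ^ 2 ≤ W := fun t =>
    le_hasSum hsq t fun j _ => mul_nonneg (pow_nonneg hγ0.le j) (sq_nonneg _)
  have hW : 0 ≤ W := le_trans (by positivity) (hterm 0)
  refine ⟨3 * (B * c) ^ 2 * (1 + c) ^ 2 * W, by positivity, fun T => ?_⟩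
  have hsig : P.sigmaT ℓbar G T = B * c * (T + 1 + c) * P.γ ^ (T + 1) := by
    rw [sigmaT, ← Finset.sum_div, ← Finset.sum_mul, ← Finset.sum_mul, hc]
    ring
  have hT : (T : ℝ) + 1 + c ≤ (1 + c) * (T + 1) := by
    nlinarith [mul_nonneg hc0.le (Nat.cast_nonneg (α := ℝ) T)]
  have hpow : P.γ ^ (T + 1) ≤ P.γ ^ T := pow_le_pow_of_le_one hγ0.le P.γ_lt_one.le (Nat.le_succ T)
  calc 3 * P.sigmaT ℓbar G T ^ 2
      = 3 * (B * c) ^ 2 * ((T + 1 + c) ^ 2 * (P.γ ^ (T + 1)) ^ 2) := by rw [hsig]; ring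
    _ ≤ 3 * (B * c) ^ 2 * (((1 + c) * (T + 1)) ^ 2 * (P.γ ^ T) ^ 2) := by gcongr
    _ = 3 * (B * c) ^ 2 * (1 + c) ^ 2 * (P.γ ^ T * ((T : ℝ) + 1) ^ 2) * P.γ ^ T := by ring
    _ ≤ 3 * (B * c) ^ 2 * (1 + c) ^ 2 * W * P.γ ^ T := by
        gcongr
        exact hterm T

theorem log_two_le_log_one_div {ε : ℝ} (h0 : 0 < ε) (h1 : ε ≤ 1 / 2) :
    Real.log 2 ≤ Real.log (1 / ε) := by
  refine Real.log_le_log two_pos ?_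
  rw [le_div_iff₀ h0]
  linarith

/-- A geometric sequence is below `ε` after a number of steps of the order `log (1/ε)`. -/
theorem exists_geometric_le {γ C : ℝ} (h0 : 0 < γ) (h1 : γ < 1) (hC : 0 ≤ C) :
    ∃ c : ℝ, 0 < c ∧ ∀ (ε : ℝ) (T : ℕ), 0 < ε → ε ≤ 1 / 2 → c * Real.log (1 / ε) ≤ T →
      C * γ ^ T ≤ ε / 3 := by
  have hlog : 0 < -Real.log γ := neg_pos.2 (Real.log_neg h0 h1)
  have hlog2 : 0 < Real.log 2 := Real.log_pos one_lt_two
  have hC1 : 0 ≤ Real.log (3 * C + 1) := Real.log_nonneg (by linarith)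
  -- It suffices that `γ^T ≤ ε / (3C + 1)`, that is `T * (-log γ) ≥ log (1/ε) + log (3C + 1)`; as
  -- `log (1/ε) ≥ log 2`, the constant term is a multiple of `log (1/ε)`.
  refine ⟨(1 + Real.log (3 * C + 1) / Real.log 2) / -Real.log γ, by positivity, ?_⟩
  intro ε T hε hε2 hT
  have hΛ := log_two_le_log_one_div hε hε2
  rw [div_mul_eq_mul_div, div_le_iff₀ hlog, add_mul, one_mul] at hT
  have h2 : Real.log (3 * C + 1) ≤ Real.log (3 * C + 1) / Real.log 2 * Real.log (1 / ε) := by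
    rw [div_mul_eq_mul_div, le_div_iff₀ hlog2]
    gcongr
  have h3 : γ ^ T ≤ ε / (3 * C + 1) := by
    rw [← Real.log_le_log_iff (by positivity) (by positivity), Real.log_pow,
      Real.log_div hε.ne' (by positivity)]
    rw [one_div, Real.log_inv] at hT h2
    linarith
  calc C * γ ^ T ≤ C * (ε / (3 * C + 1)) := by gcongr
    _ ≤ ε / 3 := by
        rw [← mul_div_assoc, div_le_div_iff₀ (by positivity) (by norm_num)]
        nlinarith

/-- Rounding up costs at most `1 ≤ y / b`, so a lower bound `b` on `y` keeps the order of magnitude.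
-/
theorem exists_nat_between {b c y : ℝ} (hb : 0 < b) (hc : 0 < c) (hy : b ≤ y) :
    ∃ n : ℕ, 0 < n ∧ c * y ≤ n ∧ n ≤ (c + 1 / b) * y := by
  have hy0 : 0 < y := hb.trans_le hy
  refine ⟨⌈c * y⌉₊, Nat.ceil_pos.2 (by positivity), Nat.le_ceil _, ?_⟩
  refine (Nat.ceil_lt_add_one (by positivity)).le.trans ?_
  have : 1 ≤ 1 / b * y := by rw [div_mul_eq_mul_div, one_mul, le_div_iff₀ hb, one_mul]; exact hy
  linarith

/-- Serves to absorb the `2` in `log (2K/δ)`: from `K/δ ≥ 2` follows `log (2K/δ) ≤ 2 log (K/δ)`. -/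
theorem two_le_natCast_div {c ε δ : ℝ} {K : ℕ} (hc : 1 ≤ c) (hε : 0 < ε) (hε2 : ε ≤ 1 / 2)
    (hδ : 0 < δ) (hδ1 : δ < 1) (hK : c / ε ≤ K) : 2 ≤ K / δ := by
  have h2 : 2 ≤ c / ε := by rw [le_div_iff₀ hε]; linarith
  rw [le_div_iff₀ hδ]
  linarith

theorem exists_complexity (hl : P.LossBounded ℓbar) {α : ℝ} (hα : 0 < α) (D : ℕ) {ξ : ℕ → ℝ}
    (hξ : ∀ i ∈ Finset.Icc 1 D, 0 ≤ ξ i) (init : ℤ → EuclideanSpace ℝ (Fin d)) :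
    ∃ cT cK cN CT CK CN : ℝ, 0 < cT ∧ 0 < cK ∧ 0 < cN ∧
      ∀ ε δ : ℝ, 0 < ε → ε ≤ 1 / 2 → 0 < δ → δ < 1 →
        (∀ T K N : ℕ, cT * Real.log (1 / ε) ≤ T → cK / ε ≤ K →
          cN * (Real.log (K / δ) / ε) ≤ N →
          P.rateBound ℓbar G α D ξ init T K N δ ≤ ε) ∧
        ∃ T K N : ℕ, 0 < K ∧ 0 < N ∧
          cT * Real.log (1 / ε) ≤ T ∧ T ≤ CT * Real.log (1 / ε) ∧
          cK / ε ≤ K ∧ K ≤ CK / ε ∧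
          cN * (Real.log (K / δ) / ε) ≤ N ∧ N ≤ CN * (Real.log (K / δ) / ε) := by
  obtain ⟨C, hC, hCT⟩ := P.exists_sigmaT_sq_le ℓbar G
  obtain ⟨cT, hcT, hT⟩ := exists_geometric_le P.γ_pos P.γ_lt_one hC
  set V := P.lyapunov α D ξ init 1 with hV
  have hV0 : 0 ≤ V := lyapunov_nonneg hl hα hξ init 1
  set H := 42 * (M * ∑ m, P.devBound ℓbar G m ^ 2) with hH
  have hH0 : 0 ≤ H := by positivity
  have hlog2 : 0 < Real.log 2 := Real.log_pos one_lt_two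
  have hcK : 1 ≤ 1 + 6 * V / α := le_add_of_nonneg_right (by positivity)
  -- `6V/α` makes `2V/(αK) ≤ ε/3`, and the added `1` forces `K/δ ≥ 2`. `6H` collects the `3` of
  -- `ε/3` and the `2` of `log (2K/δ) ≤ 2 log (K/δ)`, and its added `1` keeps `N` positive. The
  -- upper constants add the rounding cost `1/b`, with `b` equal to `log 2`, `1` and `log 2`.
  refine ⟨cT, 1 + 6 * V / α, 1 + 6 * H, cT + 1 / Real.log 2, 1 + 6 * V / α + 1 / 1,
    1 + 6 * H + 1 / Real.log 2, hcT, by positivity, by positivity, ?_⟩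
  intro ε δ hε hε2 hδ hδ1
  constructor
  · intro T K N hT' hK hN
    have hKδ := two_le_natCast_div hcK hε hε2 hδ hδ1 hK
    have hKpos : (0 : ℝ) < K := lt_of_lt_of_le (by positivity) hK
    have hlogK : 0 < Real.log (K / δ) := Real.log_pos (by linarith)
    have hNpos : (0 : ℝ) < N := lt_of_lt_of_le (by positivity) hN
    have hlog : Real.log (2 * K / δ) ≤ 2 * Real.log (K / δ) := by
      rw [mul_div_assoc, Real.log_mul two_ne_zero (by linarith)]
      have := Real.log_le_log two_pos hKδ
      linarith
    have h1 : 2 / (α * K) * V ≤ ε / 3 := by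
      rw [div_le_iff₀ hε] at hK
      rw [div_mul_eq_mul_div, div_le_div_iff₀ (by positivity) (by norm_num)]
      have : 6 * V ≤ α * (1 + 6 * V / α) := by
        rw [mul_add, mul_div_cancel₀ _ hα.ne']; linarith
      calc 2 * V * 3 = 6 * V := by ring
        _ ≤ α * (1 + 6 * V / α) := this
        _ ≤ α * (K * ε) := by gcongr
        _ = ε * (α * K) := by ring
    have h2 : 3 * P.sigmaT ℓbar G T ^ 2 ≤ ε / 3 := (hCT T).trans (hT ε T hε hε2 hT')
    have h3 : 21 * P.sigmaSq ℓbar G N K δ ≤ ε / 3 := by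
      have hsig : 21 * P.sigmaSq ℓbar G N K δ = H * Real.log (2 * K / δ) / N := by
        simp only [sigmaSq, sigmaSqLearner]
        rw [← Finset.sum_div, ← Finset.mul_sum, hH]
        ring
      rw [hsig, div_le_div_iff₀ hNpos (by norm_num)]
      rw [← mul_div_assoc, div_le_iff₀ hε] at hN
      calc H * Real.log (2 * K / δ) * 3 ≤ H * (2 * Real.log (K / δ)) * 3 := by gcongr
        _ ≤ (1 + 6 * H) * Real.log (K / δ) := by linarith
        _ ≤ N * ε := hN
        _ = ε * N := by ring
    rw [rateBound]
    linarith
  · obtain ⟨T, -, hT1, hT2⟩ := exists_nat_between hlog2 hcT (log_two_le_log_one_div hε hε2)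
    obtain ⟨K, hK0, hK1, hK2⟩ := exists_nat_between one_pos (zero_lt_one.trans_le hcK)
      (show 1 ≤ 1 / ε by rw [le_div_iff₀ hε]; linarith)
    rw [mul_one_div] at hK1 hK2
    have hKδ := two_le_natCast_div hcK hε hε2 hδ hδ1 hK1
    have hX : Real.log 2 ≤ Real.log (K / δ) / ε := by
      rw [le_div_iff₀ hε]
      have := Real.log_le_log two_pos hKδ
      nlinarith
    obtain ⟨N, hN0, hN1, hN2⟩ := exists_nat_between hlog2
      (show 0 < 1 + 6 * H by positivity) hX
    exact ⟨T, K, N, hK0, hN0, hT1, hT2, hK1, hK2, hN1, hN2⟩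

end Complexity

end DRLProblem

theorem theorem1 {S A Ω : Type*} [MeasurableSpace S] [MeasurableSpace A] [mΩ : MeasurableSpace Ω]
    {d M : ℕ} (hM : 0 < M) (P : DRLProblem S A d M)
    (ℓbar : Fin M → ℝ) (G F : ℝ) (hloss : P.LossBounded ℓbar) (hscore : P.ScoreBounded G F) :
    -- the objective is smooth, with an explicit constant
    (Differentiable ℝ P.totalLoss ∧
      ∀ θ₁ θ₂, ‖gradient P.totalLoss θ₁ - gradient P.totalLoss θ₂‖ ≤
        P.smoothConst ℓbar G F * ‖θ₁ - θ₂‖) ∧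
    -- convergence of LAPG, whenever `L` is a smoothness constant of the objective
    ∀ L : ℝ, 0 < L →
      (∀ θ₁ θ₂, ‖gradient P.totalLoss θ₁ - gradient P.totalLoss θ₂‖ ≤ L * ‖θ₁ - θ₂‖) →
    ∀ (D : ℕ) (ξ : ℕ → ℝ) (α : ℝ), (∀ i ∈ Finset.Icc 1 D, 0 ≤ ξ i) → 0 < α →
      α ≤ (1 - 3 * ∑ i ∈ Finset.Icc 1 D, ξ i) / L →
    ∀ init : ℤ → EuclideanSpace ℝ (Fin d),
      (∀ (T K N : ℕ) (δ : ℝ), 0 < K → 0 < N → 0 < δ → δ < 1 →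
        ∀ (μ : Measure Ω) [IsProbabilityMeasure μ] (ℱ : Filtration ℕ mΩ)
          (x : ℕ → Fin M → Fin N → Ω → Fin (T + 1) → S × A)
          (g : ℕ → Fin M → Ω → EuclideanSpace ℝ (Fin d))
          (θ : ℤ → Ω → EuclideanSpace ℝ (Fin d)),
          P.IsLAPG α D ξ (P.sigmaSqLearner ℓbar G N K δ) T K N init μ ℱ x g θ →
          1 - δ ≤ μ.real {ω | (1 / (K : ℝ)) *
              ∑ k ∈ Finset.Icc 1 K, ‖gradient P.totalLoss (θ k ω)‖ ^ 2 ≤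
            P.rateBound ℓbar G α D ξ init T K N δ}) ∧
      -- `T`, `K`, `N` of the orders `log (1/ε)`, `1/ε`, `log (K/δ)/ε` suffice for accuracy `ε`
      ∃ cT cK cN CT CK CN : ℝ, 0 < cT ∧ 0 < cK ∧ 0 < cN ∧
        ∀ ε δ : ℝ, 0 < ε → ε ≤ 1 / 2 → 0 < δ → δ < 1 →
          (∀ T K N : ℕ, cT * Real.log (1 / ε) ≤ T → cK / ε ≤ K →
            cN * (Real.log (K / δ) / ε) ≤ N →
            P.rateBound ℓbar G α D ξ init T K N δ ≤ ε) ∧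
          ∃ T K N : ℕ, 0 < K ∧ 0 < N ∧
            cT * Real.log (1 / ε) ≤ T ∧ T ≤ CT * Real.log (1 / ε) ∧
            cK / ε ≤ K ∧ K ≤ CK / ε ∧
            cN * (Real.log (K / δ) / ε) ≤ N ∧ N ≤ CN * (Real.log (K / δ) / ε) := by
  refine ⟨⟨DRLProblem.differentiable_totalLoss hscore hloss,
    DRLProblem.norm_gradient_totalLoss_sub_le hscore hloss⟩, ?_⟩
  intro L hL0 hL D ξ α hξ hα hαL init
  refine ⟨?_, DRLProblem.exists_complexity hloss hα D hξ init⟩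
  intro T K N δ hK hN hδ hδ1 μ _ ℱ x g θ h
  exact h.rate hM hscore hloss hL0 hL hξ hα hαL hK hN hδ hδ1
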